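/- Let $X_1, X_2, \ldots$ be independent real random variables with partial sums $S_n = X_1+\cdots+X_n$, let $(d_k)_{k\ge1}$ be positive constants, and put $D_N=\sum_{k=1}^N d_k$, where $D_N\to\infty$. Assume that: $(C_1)$ for some numerical sequences $a_n>0$ and $b_n\in\mathbb{R}$, $S_n/a_n-b_n$ converges in law to $H$, where $H$ is some (possibly degenerate) probability distribution on $\mathbb{R}$; $(C_2)$ $kd_k=O(1)$ or $1/(kd_k)=O(1)$ as $k\to\infty$, and for some $0<\alpha<1$ the sequence $d_kk^\alpha$ is eventually non-increasing; $(C_3)$ for some $\rho>0$, $\displaystyle d_k=O\Big(\frac{D_k}{k(\log D_k)^\rho}\Big)$ as $k\to\infty$; $(C_4)$ there are positive constants $C,\beta$ with $a_k/a_l\le C(k/l)^\beta$ for all $1\le k\le l$, and, for some $0<r<\rho$ and some integer $\mu\ge\max\{2,\,4/(\rho-r)\}$, $\displaystyle\sup_{n\ge1}\mathbb{E}\Big|\frac{S_n}{a_n}-b_n\Big|^\mu<\infty$. Then for every Lipschitz function $f:\mathbb{R}\to\mathbb{R}$ (not necessarily bounded), $f$ is $H$-integrable and $$\lim_{N\to\infty}\frac1{D_N}\sum_{k=1}^N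 d_k f\Big(\frac{S_k}{a_k}-b_k\Big)=\int_{-\infty}^\infty f(x)\,dH(x)\quad\text{almost surely.}$$ -/

import Mathlib

open MeasureTheory ProbabilityTheory Filter Asymptotics
open scoped NNReal ENNReal Topology

/-- The partial sum `S_n` of the first `n` terms of the sequence `X 0, X 1, …`; the `i`-th random
variable of the sequence (counted from one) is `X (i - 1)`. -/
def partialSum {Ω : Type*} (X : ℕ → Ω → ℝ) (n : ℕ) (ω : Ω) : ℝ :=
  ∑ i ∈ Finset.range n, X i ω

/-- The normalized partial sum `S_n / a_n - b_n`. -/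
noncomputable def normSum {Ω : Type*} (X : ℕ → Ω → ℝ) (a b : ℕ → ℝ) (n : ℕ) (ω : Ω) : ℝ :=
  partialSum X n ω / a n - b n

/-- The total weight `D_N = d_1 + ⋯ + d_N`. -/
def totalWeight (d : ℕ → ℝ) (N : ℕ) : ℝ :=
  ∑ k ∈ Finset.Icc 1 N, d k

/-!
Removing from `S_k / a_k - b_k` the contribution of the first `t` summands, where `t` is the start
of the geometric block of ratio `R` preceding that of `k`, costs only `O(R ^ (-β))` in `L^p`,
because `a_t / a_k` is at most of that order. After this truncation the block sums with indices of
one parity are independent, and since `‖U + V‖ₚ² ≤ ‖U‖ₚ² + c ‖V‖ₚ²` for independent centered `U`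
and `V`, the fluctuation of `∑ d_k f(S_k / a_k - b_k)` is of order `√(w D_N)`, where `w` bounds the
weight of a block. The growth condition on `d` gives `w = O(D_N log R / (log D_N) ^ ρ)`, so taking
for `R` a power of `log D_N` bounds the fluctuation in `L^p` by `O(D_N (log D_N) ^ (-σ))` for every
`σ < ρ / 2`.

As `p ρ > 2`, one may take `p σ > 1`; then the `p`-th moments of the normalized fluctuations are
summable along indices at which `D` is about `exp (j ^ γ)`, with `γ < 1` close to `1`. Successive
values of `D` there have ratio tending to `1`, so for `f ≥ 0` monotonicity fills the gaps. The
means converge because bounded second moments make `f(S_k / a_k - b_k)` uniformly integrable, and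
a general `f` is the difference of its positive and negative parts.
-/

section RPow

variable {p a x : ℝ}

lemma rpow_sub_rpow_le_mul_sub {u v s : ℝ} (hu : 0 ≤ u) (hv : 0 ≤ v) (hs : 1 ≤ s) :
    v ^ s - u ^ s ≤ s * v ^ (s - 1) * (v - u) := by
  have hs₀ : 0 < s := by linarith
  have hvs : v ^ s = v ^ (s - 1) * v := by
    simpa using Real.rpow_add_one' hv (y := s - 1) (by linarith)
  have amgm := Real.geom_mean_le_arith_mean2_weighted (w₁ := 1 / s) (w₂ := (s - 1) / s)
    (by positivity) (div_nonneg (by linarith) hs₀.le) (Real.rpow_nonneg hu s)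
    (Real.rpow_nonneg hv s) (by field_simp; ring)
  rw [← Real.rpow_mul hu, ← Real.rpow_mul hv, mul_one_div_cancel hs₀.ne', Real.rpow_one,
    mul_div_cancel₀ _ hs₀.ne'] at amgm
  have := mul_le_mul_of_nonneg_left amgm hs₀.le
  field_simp at this
  linear_combination this + s * hvs

lemma abs_rpow_sub_abs_rpow_le {y : ℝ} (hp : 2 ≤ p) :
    |y| ^ p - |a| ^ p ≤ p * (|y| ^ (p - 2) * y) * (y - a) := by
  have hy : |y| ^ (p - 1) = |y| ^ (p - 2) * |y| := by
    rw [← Real.rpow_add_one' (abs_nonneg y) (by linarith)]; ring_nf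
  calc |y| ^ p - |a| ^ p ≤ p * |y| ^ (p - 1) * (|y| - |a|) :=
        rpow_sub_rpow_le_mul_sub (abs_nonneg a) (abs_nonneg y) (by linarith)
    _ = p * |y| ^ (p - 2) * (y ^ 2 - |y * a|) := by rw [hy, abs_mul, ← sq_abs y]; ring
    _ ≤ p * |y| ^ (p - 2) * (y ^ 2 - y * a) := by gcongr; exact le_abs_self _
    _ = p * (|y| ^ (p - 2) * y) * (y - a) := by ring

lemma rpow_sub_rpow_mul_le {q : ℝ} (hq : 1 ≤ q) (hax : |x| ≤ a) :
    ((a + x) ^ q - a ^ q) * x ≤ q * (2 * a) ^ (q - 1) * x ^ 2 := by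
  have ha : 0 ≤ a := (abs_nonneg x).trans hax
  obtain ⟨hax₁, hax₂⟩ := abs_le.mp hax
  rcases le_total 0 x with hx | hx
  · calc ((a + x) ^ q - a ^ q) * x ≤ q * (a + x) ^ (q - 1) * (a + x - a) * x := by
          gcongr; exact rpow_sub_rpow_le_mul_sub ha (by linarith) hq
      _ = q * (a + x) ^ (q - 1) * x ^ 2 := by ring
      _ ≤ q * (2 * a) ^ (q - 1) * x ^ 2 := by
          gcongr; linarith
  · calc ((a + x) ^ q - a ^ q) * x = (a ^ q - (a + x) ^ q) * (-x) := by ring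
      _ ≤ q * a ^ (q - 1) * (a - (a + x)) * (-x) := by
          gcongr
          · linarith
          · exact rpow_sub_rpow_le_mul_sub (by linarith) ha hq
      _ = q * a ^ (q - 1) * x ^ 2 := by ring
      _ ≤ q * (2 * a) ^ (q - 1) * x ^ 2 := by
          gcongr; linarith

lemma signed_rpow_sub_mul_le_of_abs_le (hp : 2 ≤ p) (hax : |x| ≤ |a|) :
    (|a + x| ^ (p - 2) * (a + x) - |a| ^ (p - 2) * a) * x
      ≤ p * 2 ^ p * (|a| ^ (p - 2) * x ^ 2) := by
  wlog ha : 0 ≤ a generalizing a x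
  · have := @this (-a) (-x) (by simpa using hax) (by linarith)
    simp only [abs_neg, ← neg_add, neg_sq] at this
    linarith
  have signed {y : ℝ} (hy : 0 ≤ y) : |y| ^ (p - 2) * y = y ^ (p - 1) := by
    rw [abs_of_nonneg hy, ← Real.rpow_add_one' hy (by linarith)]; ring_nf
  rw [abs_of_nonneg ha] at hax
  calc (|a + x| ^ (p - 2) * (a + x) - |a| ^ (p - 2) * a) * x
      = ((a + x) ^ (p - 1) - a ^ (p - 1)) * x := by
        rw [signed (by linarith [neg_abs_le x]), signed ha]
    _ ≤ (p - 1) * (2 * a) ^ (p - 1 - 1) * x ^ 2 := rpow_sub_rpow_mul_le (by linarith) hax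
    _ = (p - 1) * 2 ^ (p - 2) * (|a| ^ (p - 2) * x ^ 2) := by
        rw [abs_of_nonneg ha, sub_sub, Real.mul_rpow zero_le_two ha]; ring_nf
    _ ≤ p * 2 ^ p * (|a| ^ (p - 2) * x ^ 2) := by
        gcongr
        · linarith
        · exact one_le_two
        · linarith

lemma signed_rpow_sub_mul_le_of_le_abs (hp : 2 ≤ p) (hax : |a| ≤ |x|) :
    (|a + x| ^ (p - 2) * (a + x) - |a| ^ (p - 2) * a) * x ≤ p * 2 ^ p * |x| ^ p := by
  have hp₂ : 0 ≤ p - 2 := by linarith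
  have hsum : |a + x| ≤ 2 * |x| := by linarith [abs_add_le a x]
  have hxp : |x| ^ p = |x| ^ (p - 2) * |x| ^ 2 := by
    rw [← Real.rpow_natCast, ← Real.rpow_add_of_nonneg (abs_nonneg x) hp₂ (by positivity)]
    norm_num
  have h2p : (2 : ℝ) ^ p = 2 ^ (p - 2) * 4 := by
    rw [Real.rpow_sub zero_lt_two]; norm_num
  calc (|a + x| ^ (p - 2) * (a + x) - |a| ^ (p - 2) * a) * x
      ≤ |(|a + x| ^ (p - 2) * (a + x) - |a| ^ (p - 2) * a) * x| := le_abs_self _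
    _ ≤ (|a + x| ^ (p - 2) * |a + x| + |a| ^ (p - 2) * |a|) * |x| := by
        rw [abs_mul]
        gcongr
        refine (abs_sub _ _).trans_eq ?_
        simp only [abs_mul, abs_of_nonneg (Real.rpow_nonneg (abs_nonneg _) _)]
    _ ≤ ((2 * |x|) ^ (p - 2) * (2 * |x|) + (2 * |x|) ^ (p - 2) * (2 * |x|)) * |x| := by
        gcongr <;> linarith [abs_nonneg x]
    _ = 2 ^ p * |x| ^ p := by
        rw [Real.mul_rpow zero_le_two (abs_nonneg x), hxp, h2p]; ring
    _ ≤ p * 2 ^ p * |x| ^ p := by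
        gcongr
        exact le_mul_of_one_le_left (by positivity) (by linarith)

lemma abs_add_rpow_le (hp : 2 ≤ p) :
    |a + x| ^ p ≤ |a| ^ p + p * (|a| ^ (p - 2) * a) * x
      + p ^ 2 * 2 ^ p * (|a| ^ (p - 2) * x ^ 2 + |x| ^ p) := by
  have hsigned : (|a + x| ^ (p - 2) * (a + x) - |a| ^ (p - 2) * a) * x
      ≤ p * 2 ^ p * (|a| ^ (p - 2) * x ^ 2 + |x| ^ p) := by
    rcases le_total |x| |a| with hax | hax
    · refine (signed_rpow_sub_mul_le_of_abs_le hp hax).trans ?_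
      gcongr
      exact le_add_of_nonneg_right (by positivity)
    · refine (signed_rpow_sub_mul_le_of_le_abs hp hax).trans ?_
      gcongr
      exact le_add_of_nonneg_left (by positivity)
  have htangent := abs_rpow_sub_abs_rpow_le (a := a) (y := a + x) hp
  have := mul_le_mul_of_nonneg_left hsigned (by linarith : (0 : ℝ) ≤ p)
  linarith

lemma rpow_add_mul_le_add_rpow {B t c s : ℝ} (hB : 0 ≤ B) (ht : 0 ≤ t) (hc : 1 ≤ c)
    (hs : 1 ≤ s) :
    B ^ s + c * (B ^ (s - 1) * t + t ^ s) ≤ (B + 2 * c * t) ^ s := by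
  have hB' : B ≤ B + 2 * c * t := le_add_of_nonneg_right (by positivity)
  have ht' : t ≤ B + 2 * c * t := by nlinarith [mul_nonneg (sub_nonneg.mpr hc) ht]
  have split {y : ℝ} (hy : 0 ≤ y) : y ^ s = y ^ (s - 1) * y := by
    simpa using Real.rpow_add_one' hy (y := s - 1) (by linarith)
  calc B ^ s + c * (B ^ (s - 1) * t + t ^ s)
      = B ^ (s - 1) * (B + c * t) + t ^ (s - 1) * (c * t) := by rw [split hB, split ht]; ring
    _ ≤ (B + 2 * c * t) ^ (s - 1) * (B + c * t) + (B + 2 * c * t) ^ (s - 1) * (c * t) := by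
        gcongr
    _ = (B + 2 * c * t) ^ s := by rw [split (y := B + 2 * c * t) (by positivity)]; ring

end RPow

section LpSmoothness

variable {Ω : Type*} [MeasurableSpace Ω] {P : Measure Ω} {p : ℝ≥0}

lemma integral_abs_rpow_eq_lpNorm_rpow {f : Ω → ℝ} (hp : p ≠ 0) (hf : AEStronglyMeasurable f P) :
    ∫ ω, |f ω| ^ (p : ℝ) ∂P = lpNorm f p P ^ (p : ℝ) := by
  rw [lpNorm_nnreal_eq_integral_norm_rpow hp hf, ← Real.rpow_mul (by positivity),
    inv_mul_cancel₀ (by simpa using hp), Real.rpow_one]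
  rfl

variable [IsProbabilityMeasure P]

lemma lpNorm_mono_exponent {f : Ω → ℝ} {q q' : ℝ≥0∞} (hqq' : q ≤ q') (hf : MemLp f q' P) :
    lpNorm f q P ≤ lpNorm f q' P := by
  rw [← toReal_eLpNorm hf.aestronglyMeasurable, ← toReal_eLpNorm hf.aestronglyMeasurable]
  exact ENNReal.toReal_mono hf.eLpNorm_ne_top
    (eLpNorm_le_eLpNorm_of_exponent_le hqq' hf.aestronglyMeasurable)

lemma integral_abs_rpow_le_lpNorm_rpow {f : Ω → ℝ} {s : ℝ≥0} (hsp : s ≤ p) (hf : MemLp f p P) :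
    ∫ ω, |f ω| ^ (s : ℝ) ∂P ≤ lpNorm f p P ^ (s : ℝ) := by
  rcases eq_or_ne s 0 with rfl | hs
  · simp
  · rw [integral_abs_rpow_eq_lpNorm_rpow hs hf.aestronglyMeasurable]
    gcongr
    · exact lpNorm_nonneg
    · exact lpNorm_mono_exponent (mod_cast hsp) hf

lemma integrable_abs_rpow {f : Ω → ℝ} {s : ℝ} (hs : 0 ≤ s) (hsp : s ≤ p) (hf : MemLp f p P) :
    Integrable (fun ω => |f ω| ^ s) P := by
  lift s to ℝ≥0 using hs
  simpa using (hf.mono_exponent (mod_cast hsp : (s : ℝ≥0∞) ≤ p)).integrable_norm_rpow'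

lemma integrable_signed_rpow {f : Ω → ℝ} (hp : 2 ≤ p) (hf : MemLp f p P) :
    Integrable (fun ω => |f ω| ^ ((p : ℝ) - 2) * f ω) P := by
  refine (integrable_abs_rpow (s := (p : ℝ) - 1) (by linarith) (by linarith) hf).mono
    (by have := hf.aestronglyMeasurable.aemeasurable; fun_prop) (ae_of_all _ fun ω => le_of_eq ?_)
  rw [norm_mul, Real.norm_eq_abs (f ω), Real.norm_of_nonneg (by positivity),
    Real.norm_of_nonneg (by positivity), ← Real.rpow_add_one' (abs_nonneg _) (by linarith)]
  ring_nf

lemma integral_abs_add_rpow_le_of_indepFun {U V : Ω → ℝ} (hp : 2 ≤ p) (hU : MemLp U p P)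
    (hV : MemLp V p P) (hUV : IndepFun U V P) (hV₀ : ∫ ω, V ω ∂P = 0) :
    ∫ ω, |U ω + V ω| ^ (p : ℝ) ∂P ≤ ∫ ω, |U ω| ^ (p : ℝ) ∂P
      + p ^ 2 * 2 ^ (p : ℝ) *
        ((∫ ω, |U ω| ^ ((p : ℝ) - 2) ∂P) * ∫ ω, |V ω| ^ (2 : ℝ) ∂P
          + ∫ ω, |V ω| ^ (p : ℝ) ∂P) := by
  have hp' : (2 : ℝ) ≤ p := mod_cast hp
  have hψU := integrable_signed_rpow hp hU
  have hUp := integrable_abs_rpow p.2 le_rfl hU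
  have hVp := integrable_abs_rpow p.2 le_rfl hV
  have hU₂ := integrable_abs_rpow (s := (p : ℝ) - 2) (by linarith) (by linarith) hU
  have hV₂ := integrable_abs_rpow zero_le_two hp' hV
  have hind₁ : IndepFun (fun ω => |U ω| ^ ((p : ℝ) - 2) * U ω) V P :=
    hUV.comp (φ := fun u => |u| ^ ((p : ℝ) - 2) * u) (ψ := id) (by fun_prop) measurable_id
  have hind₂ : IndepFun (fun ω => |U ω| ^ ((p : ℝ) - 2)) (fun ω => |V ω| ^ (2 : ℝ)) P :=
    hUV.comp (φ := fun u => |u| ^ ((p : ℝ) - 2)) (ψ := fun v => |v| ^ (2 : ℝ)) (by fun_prop)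
      (by fun_prop)
  have hψUV : Integrable (fun ω => |U ω| ^ ((p : ℝ) - 2) * U ω * V ω) P :=
    hind₁.integrable_mul hψU (hV.integrable (mod_cast one_le_two.trans hp))
  have hUV₂ : Integrable (fun ω => |U ω| ^ ((p : ℝ) - 2) * |V ω| ^ (2 : ℝ)) P :=
    hind₂.integrable_mul hU₂ hV₂
  have linear_term : ∫ ω, |U ω| ^ ((p : ℝ) - 2) * U ω * V ω ∂P = 0 := by
    rw [hind₁.integral_fun_mul_eq_mul_integral hψU.1 hV.1, hV₀, mul_zero]
  calc ∫ ω, |U ω + V ω| ^ (p : ℝ) ∂P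
      ≤ ∫ ω, (|U ω| ^ (p : ℝ) + p * (|U ω| ^ ((p : ℝ) - 2) * U ω * V ω)
          + p ^ 2 * 2 ^ (p : ℝ) *
            (|U ω| ^ ((p : ℝ) - 2) * |V ω| ^ (2 : ℝ) + |V ω| ^ (p : ℝ))) ∂P := by
        refine integral_mono (integrable_abs_rpow p.2 le_rfl (hU.add hV)) (by fun_prop) fun ω => ?_
        simpa [mul_assoc] using abs_add_rpow_le (a := U ω) (x := V ω) hp'
    _ = _ := by
        rw [integral_add, integral_add, integral_const_mul, integral_const_mul, integral_add,
          linear_term, hind₂.integral_fun_mul_eq_mul_integral hU₂.1 hV₂.1, mul_zero, add_zero]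
        all_goals fun_prop

/-- A constant `c` for which `‖U + V‖ₚ² ≤ ‖U‖ₚ² + c ‖V‖ₚ²` whenever `U`, `V` are independent and
`V` is centered; it makes up for the missing orthogonality in `L^p` when `2 < p`. -/
noncomputable def smoothnessConst (p : ℝ) : ℝ := 2 * (p ^ 2 * 2 ^ p)

lemma smoothnessConst_nonneg (p : ℝ) : 0 ≤ smoothnessConst p := by
  unfold smoothnessConst; positivity

lemma lpNorm_add_sq_le_of_indepFun {U V : Ω → ℝ} (hp : 2 ≤ p) (hU : MemLp U p P)
    (hV : MemLp V p P) (hUV : IndepFun U V P) (hV₀ : ∫ ω, V ω ∂P = 0) :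
    lpNorm (U + V) p P ^ 2 ≤ lpNorm U p P ^ 2 + smoothnessConst p * lpNorm V p P ^ 2 := by
  have hp₀ : p ≠ 0 := (two_pos.trans_le hp).ne'
  have hc : 1 ≤ (p : ℝ) ^ 2 * 2 ^ (p : ℝ) :=
    one_le_mul_of_one_le_of_one_le (by nlinarith) (Real.one_le_rpow one_le_two (by linarith))
  have sq_rpow {y : ℝ} (hy : 0 ≤ y) (s : ℝ) : (y ^ 2) ^ (s / 2) = y ^ s := by
    rw [← Real.rpow_natCast, ← Real.rpow_mul hy]; ring_nf
  have hU₂ : ∫ ω, |U ω| ^ ((p : ℝ) - 2) ∂P ≤ lpNorm U p P ^ ((p : ℝ) - 2) := by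
    simpa [NNReal.coe_sub hp] using integral_abs_rpow_le_lpNorm_rpow (s := p - 2) tsub_le_self hU
  have hV₂ : ∫ ω, |V ω| ^ (2 : ℝ) ∂P ≤ lpNorm V p P ^ 2 := by
    simpa using integral_abs_rpow_le_lpNorm_rpow hp hV
  have hle : lpNorm (U + V) p P ^ (p : ℝ) ≤ lpNorm U p P ^ (p : ℝ) + p ^ 2 * 2 ^ (p : ℝ) *
      (lpNorm U p P ^ ((p : ℝ) - 2) * lpNorm V p P ^ 2 + lpNorm V p P ^ (p : ℝ)) := by
    rw [← integral_abs_rpow_eq_lpNorm_rpow hp₀ (hU.add hV).1,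
      ← integral_abs_rpow_eq_lpNorm_rpow hp₀ hU.1, ← integral_abs_rpow_eq_lpNorm_rpow hp₀ hV.1]
    refine (integral_abs_add_rpow_le_of_indepFun hp hU hV hUV hV₀).trans ?_
    gcongr
    exact Real.rpow_nonneg lpNorm_nonneg _
  refine (Real.rpow_le_rpow_iff (z := (p : ℝ) / 2) (by positivity)
    (by have := smoothnessConst_nonneg p; positivity) (by positivity)).mp ?_
  calc (lpNorm (U + V) p P ^ 2) ^ ((p : ℝ) / 2)
      ≤ (lpNorm U p P ^ 2) ^ ((p : ℝ) / 2) + p ^ 2 * 2 ^ (p : ℝ) *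
        ((lpNorm U p P ^ 2) ^ ((p : ℝ) / 2 - 1) * lpNorm V p P ^ 2
          + (lpNorm V p P ^ 2) ^ ((p : ℝ) / 2)) := by
        rw [show (p : ℝ) / 2 - 1 = (p - 2) / 2 by ring]
        simpa only [sq_rpow lpNorm_nonneg] using hle
    _ ≤ (lpNorm U p P ^ 2 + smoothnessConst p * lpNorm V p P ^ 2) ^ ((p : ℝ) / 2) :=
        rpow_add_mul_le_add_rpow (by positivity) (by positivity) hc (by linarith)

lemma lpNorm_sum_range_sq_le_of_indepFun {V : ℕ → Ω → ℝ} (hp : 2 ≤ p) (hV : ∀ j, MemLp (V j) p P)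
    (hind : ∀ n, IndepFun (fun ω => ∑ j ∈ Finset.range n, V j ω) (V n) P)
    (hV₀ : ∀ j, ∫ ω, V j ω ∂P = 0) (n : ℕ) :
    lpNorm (fun ω => ∑ j ∈ Finset.range n, V j ω) p P ^ 2
      ≤ smoothnessConst p * ∑ j ∈ Finset.range n, lpNorm (V j) p P ^ 2 := by
  induction n with
  | zero => simp
  | succ n ih =>
    simp only [Finset.sum_range_succ]
    rw [mul_add]
    refine (lpNorm_add_sq_le_of_indepFun hp (memLp_finsetSum _ fun j _ => hV j) (hV n) (hind n)
      (hV₀ n)).trans ?_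
    gcongr

end LpSmoothness

section IndexSigma

variable {Ω : Type*} {X : ℕ → Ω → ℝ}

/-- The σ-algebra generated by the variables `X j` with `j ∈ s`. -/
abbrev indexSigma (X : ℕ → Ω → ℝ) (s : Set ℕ) : MeasurableSpace Ω :=
  ⨆ j ∈ s, (inferInstance : MeasurableSpace ℝ).comap (X j)

lemma indexSigma_mono {s t : Set ℕ} (h : s ⊆ t) : indexSigma X s ≤ indexSigma X t :=
  biSup_mono h

lemma measurable_indexSigma {s : Set ℕ} {j : ℕ} (hj : j ∈ s) :
    Measurable[indexSigma X s] (X j) := by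
  rw [measurable_iff_comap_le]
  exact le_biSup (fun j => (inferInstance : MeasurableSpace ℝ).comap (X j)) hj

lemma indepFun_of_measurable_indexSigma [MeasurableSpace Ω] {P : Measure Ω}
    (hX : ∀ i, Measurable (X i)) (hind : iIndepFun X P) {s t : Set ℕ} (hst : Disjoint s t)
    {U V : Ω → ℝ} (hU : Measurable[indexSigma X s] U) (hV : Measurable[indexSigma X t] V) :
    IndepFun U V P := by
  have h : Indep (indexSigma X s) (indexSigma X t) P :=
    indep_iSup_of_disjoint (fun i => (hX i).comap_le) hind hst
  rw [IndepFun_iff_Indep]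
  exact indep_of_indep_of_le_left (indep_of_indep_of_le_right h hV.comap_le) hU.comap_le

end IndexSigma

section WeightedSum

variable {Ω ι : Type*} [MeasurableSpace Ω] {P : Measure Ω} {p : ℝ≥0} {s : Finset ι} {d : ι → ℝ}
  {η : ι → Ω → ℝ} {M : ℝ}

lemma lpNorm_weighted_sum_le (hd : ∀ k ∈ s, 0 ≤ d k) (hp : 1 ≤ p)
    (hη : ∀ k, MemLp (η k) p P) (hM : ∀ k ∈ s, lpNorm (η k) p P ≤ M) :
    lpNorm (fun ω => ∑ k ∈ s, d k * η k ω) p P ≤ (∑ k ∈ s, d k) * M := by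
  have hsum : (fun ω => ∑ k ∈ s, d k * η k ω) = ∑ k ∈ s, d k • η k := by
    ext ω; simp [Finset.sum_apply]
  rw [hsum, Finset.sum_mul]
  refine (lpNorm_sum_le (fun k _ => (hη k).const_smul _) (mod_cast hp)).trans
    (Finset.sum_le_sum fun k hk => ?_)
  rw [lpNorm_const_smul, coe_nnnorm, Real.norm_of_nonneg (hd k hk)]
  exact mul_le_mul_of_nonneg_left (hM k hk) (hd k hk)

lemma lpNorm_weighted_sum_sq_le (hd : ∀ k ∈ s, 0 ≤ d k) (hp : 1 ≤ p)
    (hη : ∀ k, MemLp (η k) p P) (hM : ∀ k ∈ s, lpNorm (η k) p P ≤ M) {w : ℝ}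
    (hw : ∑ k ∈ s, d k ≤ w) :
    lpNorm (fun ω => ∑ k ∈ s, d k * η k ω) p P ^ 2 ≤ M ^ 2 * w * ∑ k ∈ s, d k := by
  calc lpNorm (fun ω => ∑ k ∈ s, d k * η k ω) p P ^ 2 ≤ ((∑ k ∈ s, d k) * M) ^ 2 :=
        pow_le_pow_left₀ lpNorm_nonneg (lpNorm_weighted_sum_le hd hp hη hM) 2
    _ = M ^ 2 * (∑ k ∈ s, d k) * ∑ k ∈ s, d k := by ring
    _ ≤ M ^ 2 * w * ∑ k ∈ s, d k := by gcongr; exact Finset.sum_nonneg hd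

end WeightedSum

section Blocks

lemma sum_range_two_mul {α : Type*} [AddCommMonoid α] (g : ℕ → α) (n : ℕ) :
    ∑ j ∈ Finset.range (2 * n), g j
      = ∑ i ∈ Finset.range n, g (2 * i) + ∑ i ∈ Finset.range n, g (2 * i + 1) := by
  induction n with
  | zero => simp
  | succ n ih =>
    rw [mul_add_one, Finset.sum_range_succ, Finset.sum_range_succ, ih, Finset.sum_range_succ,
      Finset.sum_range_succ]
    abel

variable {Ω : Type*} [MeasurableSpace Ω] {P : Measure Ω} [IsProbabilityMeasure P]
  {X : ℕ → Ω → ℝ} {p : ℝ≥0}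

lemma lpNorm_sum_even_or_odd_le (hX : ∀ i, Measurable (X i)) (hind : iIndepFun X P) (hp : 2 ≤ p)
    {s : ℕ → ℕ} (hs : Monotone s) {V : ℕ → Ω → ℝ}
    (hVmeas : ∀ j, Measurable[indexSigma X (Set.Ico (s j) (s (j + 2)))] (V j))
    (hV : ∀ j, MemLp (V j) p P) (hV₀ : ∀ j, ∫ ω, V j ω ∂P = 0) (e n : ℕ) :
    lpNorm (fun ω => ∑ i ∈ Finset.range n, V (2 * i + e) ω) p P
      ≤ √(smoothnessConst p * ∑ i ∈ Finset.range n, lpNorm (V (2 * i + e)) p P ^ 2) := by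
  refine Real.le_sqrt_of_sq_le (lpNorm_sum_range_sq_le_of_indepFun hp (fun _ => hV _)
    (fun m => ?_) (fun _ => hV₀ _) n)
  have hdisj : Disjoint (Set.Iio (s (2 * m + e))) (Set.Ici (s (2 * m + e))) :=
    Set.disjoint_left.mpr fun _ h h' => not_lt_of_ge (Set.mem_Ici.mp h') h
  refine indepFun_of_measurable_indexSigma hX hind hdisj
    (Finset.measurable_fun_sum _ fun i hi => (hVmeas _).mono (indexSigma_mono ?_) le_rfl)
    ((hVmeas _).mono (indexSigma_mono Set.Ico_subset_Ici_self) le_rfl)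
  exact Set.Ico_subset_Iio_self.trans
    (Set.Iio_subset_Iio (hs (by have := Finset.mem_range.mp hi; omega)))

lemma lpNorm_sum_range_two_mul_le (hX : ∀ i, Measurable (X i)) (hind : iIndepFun X P)
    (hp : 2 ≤ p) {s : ℕ → ℕ} (hs : Monotone s) {V : ℕ → Ω → ℝ}
    (hVmeas : ∀ j, Measurable[indexSigma X (Set.Ico (s j) (s (j + 2)))] (V j))
    (hV : ∀ j, MemLp (V j) p P) (hV₀ : ∀ j, ∫ ω, V j ω ∂P = 0) (n : ℕ) :
    lpNorm (fun ω => ∑ j ∈ Finset.range (2 * n), V j ω) p P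
      ≤ 2 * √(smoothnessConst p * ∑ j ∈ Finset.range (2 * n), lpNorm (V j) p P ^ 2) := by
  have hsum_le (e : ℕ) (he : ∑ i ∈ Finset.range n, lpNorm (V (2 * i + e)) p P ^ 2
      ≤ ∑ j ∈ Finset.range (2 * n), lpNorm (V j) p P ^ 2) :
      lpNorm (fun ω => ∑ i ∈ Finset.range n, V (2 * i + e) ω) p P
        ≤ √(smoothnessConst p * ∑ j ∈ Finset.range (2 * n), lpNorm (V j) p P ^ 2) :=
    (lpNorm_sum_even_or_odd_le hX hind hp hs hVmeas hV hV₀ e n).trans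
      (Real.sqrt_le_sqrt (mul_le_mul_of_nonneg_left he (smoothnessConst_nonneg p)))
  have hsplit := sum_range_two_mul (fun j => lpNorm (V j) p P ^ 2) n
  have hnonneg (e : ℕ) : 0 ≤ ∑ i ∈ Finset.range n, lpNorm (V (2 * i + e)) p P ^ 2 :=
    Finset.sum_nonneg fun _ _ => sq_nonneg _
  calc lpNorm (fun ω => ∑ j ∈ Finset.range (2 * n), V j ω) p P
      = lpNorm ((fun ω => ∑ i ∈ Finset.range n, V (2 * i + 0) ω)
          + fun ω => ∑ i ∈ Finset.range n, V (2 * i + 1) ω) p P := by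
        congr 1; ext ω; exact sum_range_two_mul (fun j => V j ω) n
    _ ≤ _ + _ := lpNorm_add_le (memLp_finsetSum _ fun _ _ => hV _)
        (mod_cast one_le_two.trans hp)
    _ ≤ 2 * √(smoothnessConst p * ∑ j ∈ Finset.range (2 * n), lpNorm (V j) p P ^ 2) := by
        rw [two_mul √_]
        exact add_le_add (hsum_le 0 (hsplit ▸ le_add_of_nonneg_right (hnonneg 1)))
          (hsum_le 1 (hsplit ▸ le_add_of_nonneg_left (hnonneg 0)))

/-- The left end of the block preceding the block `[R ^ j, R ^ (j + 1))` that consists of the `k`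
with `Nat.log R k = j`; there is nothing before the zeroth block. -/
def blockStart (R j : ℕ) : ℕ := if j = 0 then 0 else R ^ (j - 1)

lemma blockStart_mono {R : ℕ} (hR : 0 < R) : Monotone (blockStart R) := by
  intro i j hij
  unfold blockStart
  split_ifs with hi hj
  · exact le_rfl
  · exact Nat.zero_le _
  · omega
  · exact Nat.pow_le_pow_right hR (by omega)

lemma lpNorm_blocks_sum_le (hX : ∀ i, Measurable (X i)) (hind : iIndepFun X P) (hp : 2 ≤ p)
    {R : ℕ} (hR : 1 < R) {d : ℕ → ℝ} (hd : ∀ k, 1 ≤ k → 0 ≤ d k) {η : ℕ → Ω → ℝ}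
    (hηmeas : ∀ k, Measurable[indexSigma X (Set.Ico (blockStart R (Nat.log R k)) k)] (η k))
    (hη : ∀ k, MemLp (η k) p P) (hη₀ : ∀ k, ∫ ω, η k ω ∂P = 0) {M w : ℝ}
    (hM : ∀ k, 1 ≤ k → lpNorm (η k) p P ≤ M) (N : ℕ)
    (hw : ∀ j, ∑ k ∈ Finset.Icc 1 N with Nat.log R k = j, d k ≤ w) :
    lpNorm (fun ω => ∑ k ∈ Finset.Icc 1 N, d k * η k ω) p P
      ≤ 2 * M * √(smoothnessConst p * w * totalWeight d N) := by
  let B (j : ℕ) : Finset ℕ := {k ∈ Finset.Icc 1 N | Nat.log R k = j}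
  let V (j : ℕ) (ω : Ω) : ℝ := ∑ k ∈ B j, d k * η k ω
  have hp₁ : 1 ≤ p := one_le_two.trans hp
  have hM₀ : 0 ≤ M := lpNorm_nonneg.trans (hM 1 le_rfl)
  have hB {j k : ℕ} (hk : k ∈ B j) : 1 ≤ k ∧ Nat.log R k = j := by
    simp only [B, Finset.mem_filter, Finset.mem_Icc] at hk; exact ⟨hk.1.1, hk.2⟩
  have hmaps : ∀ k ∈ Finset.Icc 1 N, Nat.log R k ∈ Finset.range (2 * (N + 1)) := fun k hk => by
    have := Nat.log_le_self R k
    simp only [Finset.mem_Icc, Finset.mem_range] at hk ⊢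
    omega
  have hVmeas (j : ℕ) : Measurable[indexSigma X (Set.Ico (blockStart R j)
      (blockStart R (j + 2)))] (V j) := by
    refine Finset.measurable_fun_sum _ fun k hk =>
      ((hηmeas k).mono (indexSigma_mono ?_) le_rfl).const_mul _
    rw [(hB hk).2]
    refine Set.Ico_subset_Ico_right ?_
    simpa [blockStart, (hB hk).2] using (Nat.lt_pow_succ_log_self hR k).le
  have hV₀ (j : ℕ) : ∫ ω, V j ω ∂P = 0 := by
    simp only [V]
    rw [integral_finsetSum _ fun k _ => ((hη k).integrable (mod_cast hp₁)).const_mul _]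
    simp [integral_const_mul, hη₀]
  calc lpNorm (fun ω => ∑ k ∈ Finset.Icc 1 N, d k * η k ω) p P
      = lpNorm (fun ω => ∑ j ∈ Finset.range (2 * (N + 1)), V j ω) p P := by
        simp only [V, B, Finset.sum_fiberwise_of_maps_to hmaps]
    _ ≤ 2 * √(smoothnessConst p * ∑ j ∈ Finset.range (2 * (N + 1)), lpNorm (V j) p P ^ 2) :=
        lpNorm_sum_range_two_mul_le hX hind hp (blockStart_mono (by omega)) hVmeas
          (fun j => memLp_finsetSum _ fun k _ => (hη k).const_mul _) hV₀ _
    _ ≤ 2 * √(smoothnessConst p *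
          ∑ j ∈ Finset.range (2 * (N + 1)), M ^ 2 * w * ∑ k ∈ B j, d k) := by
        gcongr with j
        · exact smoothnessConst_nonneg p
        · exact lpNorm_weighted_sum_sq_le (fun k hk => hd k (hB hk).1) hp₁ hη
            (fun k hk => hM k (hB hk).1) (hw j)
    _ = 2 * √(M ^ 2 * (smoothnessConst p * w * totalWeight d N)) := by
        rw [← Finset.mul_sum, Finset.sum_fiberwise_of_maps_to hmaps, totalWeight]; congr 2; ring
    _ = 2 * M * √(smoothnessConst p * w * totalWeight d N) := by
        rw [Real.sqrt_mul (sq_nonneg M), Real.sqrt_sq hM₀]; ring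

end Blocks

section Centering

variable {Ω : Type*} [MeasurableSpace Ω] {P : Measure Ω} {p : ℝ≥0∞} {f : ℝ → ℝ} {K : ℝ≥0}

/-- The fluctuation of `h` about its mean. -/
noncomputable def centered (P : Measure Ω) (h : Ω → ℝ) (ω : Ω) : ℝ := h ω - ∫ ω', h ω' ∂P

lemma memLp_lipschitz_comp [IsFiniteMeasure P] (hf : LipschitzWith K f) {Y : Ω → ℝ}
    (hY : MemLp Y p P) : MemLp (fun ω => f (Y ω)) p P := by
  have hshift : MemLp ((fun y => f y - f 0) ∘ Y) p P :=
    (hf.sub (LipschitzWith.const (f 0))).comp_memLp (sub_self _) hY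
  convert hshift.add (memLp_const (f 0)) using 1
  ext ω
  simp

lemma lpNorm_lipschitz_comp_sub_le (hf : LipschitzWith K f) {Y Z : Ω → ℝ}
    (hYZ : MemLp (Y - Z) p P) :
    lpNorm (fun ω => f (Y ω) - f (Z ω)) p P ≤ K * lpNorm (Y - Z) p P := by
  calc lpNorm (fun ω => f (Y ω) - f (Z ω)) p P
      ≤ lpNorm ((K : ℝ) • fun ω => |Y ω - Z ω|) p P :=
        lpNorm_mono_real (hYZ.abs.const_smul _) fun ω => by
          simpa [Real.dist_eq] using hf.dist_le_mul (Y ω) (Z ω)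
    _ = K * lpNorm (Y - Z) p P := by
        rw [lpNorm_const_smul, ← lpNorm_fun_abs hYZ.1]; simp

lemma centered_eq_centered_sub_add {g h : Ω → ℝ} (hg : Integrable g P) (hh : Integrable h P) :
    centered P h = (centered P fun ω => h ω - g ω) + centered P g := by
  ext ω
  simp only [centered, Pi.add_apply, integral_sub hh hg]
  ring

variable [IsProbabilityMeasure P]

lemma memLp_centered {h : Ω → ℝ} (hh : MemLp h p P) : MemLp (centered P h) p P :=
  hh.sub (memLp_const _)

lemma integral_centered {h : Ω → ℝ} (hh : Integrable h P) : ∫ ω, centered P h ω ∂P = 0 := by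
  simp [centered, integral_sub hh (integrable_const _)]

lemma lpNorm_centered_le (hp : 1 ≤ p) {h : Ω → ℝ} (hh : MemLp h p P) :
    lpNorm (centered P h) p P ≤ 2 * lpNorm h p P := by
  have hmean : ‖∫ ω, h ω ∂P‖ ≤ lpNorm h p P := by
    refine (norm_integral_le_integral_norm h).trans ?_
    rw [← lpNorm_one_eq_integral_norm hh.1]
    exact lpNorm_mono_exponent hp hh
  calc lpNorm (centered P h) p P ≤ lpNorm h p P + lpNorm (fun _ : Ω => ∫ ω, h ω ∂P) p P :=
        lpNorm_sub_le hh hp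
    _ ≤ 2 * lpNorm h p P := by
        rw [lpNorm_const (zero_lt_one.trans_le hp).ne' (IsProbabilityMeasure.ne_zero P)]
        simp only [probReal_univ, Real.one_rpow, mul_one]
        linarith

lemma lpNorm_centered_lipschitz_comp_le (hp : 1 ≤ p) (hf : LipschitzWith K f) {Y : Ω → ℝ}
    (hY : MemLp Y p P) : lpNorm (centered P fun ω => f (Y ω)) p P ≤ 2 * K * lpNorm Y p P := by
  have hfY := memLp_lipschitz_comp hf hY
  have hshift : centered P (fun ω => f (Y ω)) = centered P (fun ω => f (Y ω) - f 0) := by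
    ext ω
    simp [centered, integral_sub (hfY.integrable hp) (integrable_const _)]
  rw [hshift, mul_assoc]
  refine (lpNorm_centered_le hp (hfY.sub (memLp_const (f 0)))).trans ?_
  gcongr
  have h := lpNorm_lipschitz_comp_sub_le hf (Y := Y) (Z := 0) (by simpa using hY)
  rwa [sub_zero] at h

lemma lpNorm_sum_centered_lipschitz_comp_le {ι : Type*} {s : Finset ι} {d : ι → ℝ} {p : ℝ≥0}
    (hd : ∀ k ∈ s, 0 ≤ d k) (hp : 1 ≤ p) (hf : LipschitzWith K f) {Y Z : ι → Ω → ℝ}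
    (hY : ∀ k, MemLp (Y k) p P) (hZ : ∀ k, MemLp (Z k) p P) {δ : ℝ}
    (hδ : ∀ k ∈ s, lpNorm (Z k - Y k) p P ≤ δ) :
    lpNorm (fun ω => ∑ k ∈ s, d k * centered P (fun ω => f (Z k ω)) ω) p P
      ≤ (∑ k ∈ s, d k) * (2 * (K * δ))
        + lpNorm (fun ω => ∑ k ∈ s, d k * centered P (fun ω => f (Y k ω)) ω) p P := by
  have hp' : (1 : ℝ≥0∞) ≤ p := mod_cast hp
  have hfY (k : ι) := memLp_lipschitz_comp hf (hY k)
  have hfZ (k : ι) := memLp_lipschitz_comp hf (hZ k)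
  have hdiff (k : ι) := memLp_centered ((hfZ k).sub (hfY k))
  calc lpNorm (fun ω => ∑ k ∈ s, d k * centered P (fun ω => f (Z k ω)) ω) p P
      = lpNorm ((fun ω => ∑ k ∈ s, d k * centered P (fun ω => f (Z k ω) - f (Y k ω)) ω)
          + fun ω => ∑ k ∈ s, d k * centered P (fun ω => f (Y k ω)) ω) p P := by
        congr 1
        ext ω
        rw [Pi.add_apply, ← Finset.sum_add_distrib]
        refine Finset.sum_congr rfl fun k _ => ?_
        rw [centered_eq_centered_sub_add ((hfY k).integrable hp') ((hfZ k).integrable hp'),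
          Pi.add_apply, mul_add]
    _ ≤ _ + _ := lpNorm_add_le (memLp_finsetSum _ fun k _ => (hdiff k).const_mul _) hp'
    _ ≤ _ := by
        gcongr
        refine lpNorm_weighted_sum_le hd hp hdiff fun k hk => ?_
        refine (lpNorm_centered_le hp' ((hfZ k).sub (hfY k))).trans ?_
        gcongr
        exact (lpNorm_lipschitz_comp_sub_le hf ((hZ k).sub (hY k))).trans (by gcongr; exact hδ k hk)

end Centering

section Truncation

/-- The normalized sum `S_k / a_k - b_k` with the contribution of the first `t` summands removed:
for `t ≤ k` it depends only on the summands with index in `[t, k)`. Subtracting a multiple of the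
normalized sum `S_t / a_t - b_t` instead of `S_t / a_k` makes the difference small in `L^p`. -/
noncomputable def truncNormSum {Ω : Type*} (X : ℕ → Ω → ℝ) (a b : ℕ → ℝ) (t k : ℕ) (ω : Ω) : ℝ :=
  normSum X a b k ω - (if t = 0 then 0 else a t / a k) * normSum X a b t ω

lemma blockStart_log_le {R : ℕ} (hR : 0 < R) (k : ℕ) : blockStart R (Nat.log R k) ≤ k := by
  unfold blockStart
  split_ifs with h
  · exact Nat.zero_le k
  · have hk : k ≠ 0 := by rintro rfl; simp at h
    exact (Nat.pow_le_pow_right hR (Nat.sub_le _ _)).trans (Nat.pow_log_le_self R hk)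

lemma blockStart_log_mul_le (R k : ℕ) : blockStart R (Nat.log R k) * R ≤ k := by
  unfold blockStart
  split_ifs with h
  · simp
  · have hk : k ≠ 0 := by rintro rfl; simp at h
    rw [← pow_succ, Nat.sub_add_cancel (Nat.one_le_iff_ne_zero.mpr h)]
    exact Nat.pow_log_le_self R hk

variable {Ω : Type*} {X : ℕ → Ω → ℝ} {a b : ℕ → ℝ}

lemma measurable_truncNormSum (ha : ∀ n, 1 ≤ n → 0 < a n) {t k : ℕ} (htk : t ≤ k) :
    Measurable[indexSigma X (Set.Ico t k)] (truncNormSum X a b t k) := by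
  have hrepr : truncNormSum X a b t k = fun ω =>
      (∑ j ∈ Finset.Ico t k, X j ω + if t = 0 then 0 else a t * b t) / a k - b k := by
    ext ω
    rw [Finset.sum_Ico_eq_sub _ htk]
    unfold truncNormSum normSum partialSum
    split_ifs with h
    · simp [h]
    · have := (ha t (Nat.one_le_iff_ne_zero.mpr h)).ne'
      field_simp
      ring
  rw [hrepr]
  exact ((Finset.measurable_fun_sum _ fun j hj =>
    measurable_indexSigma (Finset.mem_Ico.1 hj)).add_const _).div_const _ |>.sub_const _

variable [MeasurableSpace Ω] {P : Measure Ω} {p : ℝ≥0}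

lemma measurable_normSum (hX : ∀ i, Measurable (X i)) (n : ℕ) : Measurable (normSum X a b n) :=
  ((Finset.measurable_fun_sum _ fun j _ => hX j).div_const _).sub_const _

lemma memLp_truncNormSum {q : ℝ≥0∞} (hLp : ∀ k, MemLp (normSum X a b k) q P) (t k : ℕ) :
    MemLp (truncNormSum X a b t k) q P :=
  (hLp k).sub ((hLp t).const_mul _)

lemma lpNorm_normSum_sub_truncNormSum_le (ha : ∀ n, 1 ≤ n → 0 < a n) {C β : ℝ} (hC : 0 ≤ C)
    (hβ : 0 ≤ β) (hab : ∀ k l : ℕ, 1 ≤ k → k ≤ l → a k / a l ≤ C * ((k : ℝ) / (l : ℝ)) ^ β)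
    {q : ℝ≥0∞} {M : ℝ} (hM : ∀ k, 1 ≤ k → lpNorm (normSum X a b k) q P ≤ M) {t k : ℕ}
    (hk : 1 ≤ k) (htk : t ≤ k) {δ : ℝ} (hδ : 0 ≤ δ) (htkδ : (t : ℝ) / k ≤ δ) :
    lpNorm (normSum X a b k - truncNormSum X a b t k) q P ≤ C * δ ^ β * M := by
  have hdiff : normSum X a b k - truncNormSum X a b t k
      = (if t = 0 then 0 else a t / a k) • normSum X a b t := by
    ext ω; simp [truncNormSum]
  have hM₀ : 0 ≤ M := lpNorm_nonneg.trans (hM 1 le_rfl)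
  rw [hdiff, lpNorm_const_smul, coe_nnnorm]
  split_ifs with ht
  · simp only [norm_zero, zero_mul]; positivity
  · have ht₁ : 1 ≤ t := Nat.one_le_iff_ne_zero.mpr ht
    rw [Real.norm_of_nonneg (div_pos (ha t ht₁) (ha k hk)).le]
    gcongr
    · exact lpNorm_nonneg
    · exact (hab t k ht₁ htk).trans (by gcongr)
    · exact hM t ht₁

variable [IsProbabilityMeasure P]

lemma lpNorm_sum_centered_le (hX : ∀ i, Measurable (X i)) (hind : iIndepFun X P)
    (ha : ∀ n, 1 ≤ n → 0 < a n) {C β : ℝ} (hC : 0 ≤ C) (hβ : 0 ≤ β)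
    (hab : ∀ k l : ℕ, 1 ≤ k → k ≤ l → a k / a l ≤ C * ((k : ℝ) / (l : ℝ)) ^ β)
    (hp : 2 ≤ p) (hLp : ∀ k, MemLp (normSum X a b k) p P) {M : ℝ}
    (hM : ∀ k, 1 ≤ k → lpNorm (normSum X a b k) p P ≤ M)
    {d : ℕ → ℝ} (hd : ∀ k, 1 ≤ k → 0 ≤ d k) {f : ℝ → ℝ} {K : ℝ≥0} (hf : LipschitzWith K f)
    {R : ℕ} (hR : 1 < R) (N : ℕ) {w : ℝ}
    (hw : ∀ j, ∑ k ∈ Finset.Icc 1 N with Nat.log R k = j, d k ≤ w) :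
    lpNorm (fun ω => ∑ k ∈ Finset.Icc 1 N, d k * centered P (fun ω => f (normSum X a b k ω)) ω) p P
      ≤ 2 * K * C * M * (totalWeight d N * (R : ℝ)⁻¹ ^ β)
        + 4 * K * (1 + C) * M * √(smoothnessConst p * w * totalWeight d N) := by
  have hp₁ : (1 : ℝ≥0∞) ≤ p := mod_cast one_le_two.trans hp
  have hR₀ : (0 : ℝ) < R := by positivity
  have hRβ : (R : ℝ)⁻¹ ^ β ≤ 1 :=
    Real.rpow_le_one (by positivity) (inv_le_one_of_one_le₀ (mod_cast hR.le)) hβ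
  have hM₀ : 0 ≤ M := lpNorm_nonneg.trans (hM 1 le_rfl)
  let Y (k : ℕ) := truncNormSum X a b (blockStart R (Nat.log R k)) k
  have hY (k : ℕ) : MemLp (Y k) p P := memLp_truncNormSum hLp _ k
  have hstart (k : ℕ) : blockStart R (Nat.log R k) ≤ k := blockStart_log_le (by omega) k
  have hZY (k : ℕ) (hk : 1 ≤ k) :
      lpNorm (normSum X a b k - Y k) p P ≤ C * (R : ℝ)⁻¹ ^ β * M := by
    refine lpNorm_normSum_sub_truncNormSum_le ha hC hβ hab hM hk (hstart k) (by positivity) ?_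
    rw [div_le_iff₀ (by positivity), ← div_eq_inv_mul, le_div_iff₀ hR₀]
    exact_mod_cast blockStart_log_mul_le R k
  have hYM (k : ℕ) (hk : 1 ≤ k) : lpNorm (Y k) p P ≤ (1 + C) * M := by
    calc lpNorm (Y k) p P ≤ lpNorm (normSum X a b k) p P + lpNorm (normSum X a b k - Y k) p P :=
          lpNorm_le_lpNorm_add_lpNorm_sub (hLp k) hp₁
      _ ≤ M + C * 1 * M := add_le_add (hM k hk) ((hZY k hk).trans (by gcongr))
      _ = (1 + C) * M := by ring
  have hblocks : lpNorm (fun ω => ∑ k ∈ Finset.Icc 1 N, d k * centered P (fun ω => f (Y k ω)) ω) p P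
      ≤ 2 * (2 * K * ((1 + C) * M)) * √(smoothnessConst p * w * totalWeight d N) := by
    refine lpNorm_blocks_sum_le hX hind hp hR hd (fun k => ?_)
      (fun k => memLp_centered (memLp_lipschitz_comp hf (hY k)))
      (fun k => integral_centered ((memLp_lipschitz_comp hf (hY k)).integrable hp₁))
      (fun k hk => ?_) N hw
    · exact (hf.continuous.measurable.comp (measurable_truncNormSum ha (hstart k))).sub_const _
    · exact (lpNorm_centered_lipschitz_comp_le hp₁ hf (hY k)).trans (by gcongr; exact hYM k hk)
  refine (lpNorm_sum_centered_lipschitz_comp_le (fun k hk => hd k (Finset.mem_Icc.mp hk).1)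
    (one_le_two.trans hp) hf hY hLp fun k hk => hZY k (Finset.mem_Icc.mp hk).1).trans
    ((add_le_add_right hblocks _).trans_eq ?_)
  rw [totalWeight]
  ring

end Truncation

section Weights

lemma exists_eventually_forall_le_mul {u v : ℕ → ℝ} (huv : u =O[atTop] v) {n₀ : ℕ}
    (hmono : MonotoneOn v (Set.Ici n₀)) (hv : Tendsto v atTop atTop) :
    ∃ C : ℝ, 0 < C ∧ ∀ᶠ N in atTop, ∀ k ≤ N, u k ≤ C * v N := by
  obtain ⟨c, hc, hcb⟩ := huv.exists_pos
  obtain ⟨n₁, hn₁⟩ := eventually_atTop.mp (hcb.bound.and (hv.eventually_ge_atTop 0))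
  let S := ∑ k ∈ Finset.range (max n₀ n₁), |u k|
  refine ⟨c + 1, by positivity, ?_⟩
  filter_upwards [hv.eventually_ge_atTop S, hv.eventually_ge_atTop 0, eventually_ge_atTop n₀]
    with N hS hN₀ hnN k hkN
  rcases lt_or_ge k (max n₀ n₁) with hk | hk
  · calc u k ≤ |u k| := le_abs_self _
      _ ≤ S := Finset.single_le_sum (f := fun k => |u k|) (fun _ _ => abs_nonneg _)
          (Finset.mem_range.mpr hk)
      _ ≤ (c + 1) * v N := hS.trans (le_mul_of_one_le_left hN₀ (by linarith))
  · obtain ⟨hbound, hvk⟩ := hn₁ k ((le_max_right _ _).trans hk)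
    calc u k ≤ c * v k := by
          rw [Real.norm_of_nonneg hvk] at hbound
          exact (le_abs_self _).trans hbound
      _ ≤ (c + 1) * v N := by
          gcongr
          · linarith
          · exact hmono ((le_max_left _ _).trans hk) hnN hkN

lemma monotoneOn_div_log_rpow {ρ : ℝ} (hρ : 0 < ρ) :
    MonotoneOn (fun x => x / Real.log x ^ ρ) (Set.Ici (Real.exp ρ)) := by
  intro x hx y hy hxy
  have hpos {z : ℝ} (hz : z ∈ Set.Ici (Real.exp ρ)) : 0 < z ∧ 0 < Real.log z := by
    have hz₁ : 1 < z := (Real.one_lt_exp_iff.mpr hρ).trans_le hz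
    exact ⟨zero_lt_one.trans hz₁, Real.log_pos hz₁⟩
  have hrepr {z : ℝ} (hz : z ∈ Set.Ici (Real.exp ρ)) :
      z / Real.log z ^ ρ = ((Real.log z / z ^ ρ⁻¹) ^ ρ)⁻¹ := by
    rw [Real.div_rpow (hpos hz).2.le (by have := (hpos hz).1; positivity),
      Real.rpow_inv_rpow (hpos hz).1.le hρ.ne', inv_div]
  have hanti := Real.log_div_self_rpow_antitoneOn (inv_pos.mpr hρ)
  rw [inv_inv] at hanti
  have hbase : 0 < Real.log y / y ^ ρ⁻¹ :=
    div_pos (hpos hy).2 (Real.rpow_pos_of_pos (hpos hy).1 _)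
  simp only [hrepr hx, hrepr hy]
  exact inv_anti₀ (Real.rpow_pos_of_pos hbase ρ)
    (Real.rpow_le_rpow hbase.le (hanti hx hy hxy) hρ.le)

lemma tendsto_div_log_rpow_atTop (ρ : ℝ) :
    Tendsto (fun x => x / Real.log x ^ ρ) atTop atTop := by
  have hlittle : Tendsto (fun x => Real.log x ^ ρ / x) atTop (𝓝 0) := by
    simpa using (isLittleO_log_rpow_rpow_atTop ρ one_pos).tendsto_div_nhds_zero
  have hpos : ∀ᶠ x : ℝ in atTop, 0 < Real.log x ^ ρ / x := by
    filter_upwards [eventually_gt_atTop 1] with x hx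
    exact div_pos (Real.rpow_pos_of_pos (Real.log_pos hx) ρ) (by linarith)
  exact (tendsto_nhdsWithin_iff.mpr ⟨hlittle, hpos⟩).inv_tendsto_nhdsGT_zero.congr
    fun x => inv_div _ _

lemma totalWeight_mono {d : ℕ → ℝ} (hd : ∀ k, 1 ≤ k → 0 ≤ d k) : Monotone (totalWeight d) :=
  fun _ _ hmn => Finset.sum_le_sum_of_subset_of_nonneg (Finset.Icc_subset_Icc_right hmn)
    fun k hk _ => hd k (Finset.mem_Icc.mp hk).1

lemma totalWeight_nonneg {d : ℕ → ℝ} (hd : ∀ k, 1 ≤ k → 0 ≤ d k) (N : ℕ) : 0 ≤ totalWeight d N :=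
  Finset.sum_nonneg fun k hk => hd k (Finset.mem_Icc.mp hk).1

lemma exists_eventually_weight_le {d : ℕ → ℝ} (hd : ∀ k, 1 ≤ k → 0 ≤ d k)
    (hD : Tendsto (totalWeight d) atTop atTop) {ρ : ℝ} (hρ : 0 < ρ)
    (hdD : d =O[atTop]
      (fun k : ℕ => totalWeight d k / ((k : ℝ) * (Real.log (totalWeight d k)) ^ ρ))) :
    ∃ C : ℝ, 0 < C ∧ ∀ᶠ N in atTop, ∀ k, 1 ≤ k → k ≤ N →
      d k ≤ C * (totalWeight d N / Real.log (totalWeight d N) ^ ρ) * (k : ℝ)⁻¹ := by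
  have hbigO : (fun k : ℕ => k * d k) =O[atTop]
      fun k => totalWeight d k / Real.log (totalWeight d k) ^ ρ := by
    refine ((isBigO_refl (fun k : ℕ => (k : ℝ)) atTop).mul hdD).congr' .rfl ?_
    filter_upwards [eventually_ne_atTop 0] with k hk
    have hk' : (k : ℝ) ≠ 0 := Nat.cast_ne_zero.mpr hk
    rw [← mul_div_assoc, mul_div_mul_left _ _ hk']
  obtain ⟨n₀, hn₀⟩ := eventually_atTop.mp (hD.eventually_ge_atTop (Real.exp ρ))
  obtain ⟨C, hC, hCb⟩ := exists_eventually_forall_le_mul hbigO (n₀ := n₀)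
    (fun m hm n hn hmn =>
      monotoneOn_div_log_rpow hρ (hn₀ m hm) (hn₀ n hn) (totalWeight_mono hd hmn))
    ((tendsto_div_log_rpow_atTop ρ).comp hD)
  refine ⟨C, hC, hCb.mono fun N hN k hk hkN => ?_⟩
  rw [← div_eq_mul_inv, le_div_iff₀ (by positivity), mul_comm]
  exact hN k hkN

lemma inv_le_two_mul_log_sub {k : ℕ} (hk : 1 ≤ k) :
    (k : ℝ)⁻¹ ≤ 2 * (Real.log ((k + 1 : ℕ) : ℝ) - Real.log k) := by
  have hk₁ : (1 : ℝ) ≤ k := mod_cast hk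
  calc (k : ℝ)⁻¹ ≤ 2 * (1 - (((k : ℝ) + 1) / k)⁻¹) := by
        rw [← sub_nonneg]
        have : 2 * (1 - (((k : ℝ) + 1) / k)⁻¹) - (k : ℝ)⁻¹ = (k - 1) / (k * (k + 1)) := by
          field_simp
          ring
        rw [this]
        exact div_nonneg (by linarith) (by positivity)
    _ ≤ 2 * Real.log (((k : ℝ) + 1) / k) := by
        gcongr
        exact Real.one_sub_inv_le_log_of_pos (by positivity)
    _ = 2 * (Real.log ((k + 1 : ℕ) : ℝ) - Real.log k) := by
        rw [Real.log_div (by positivity) (by positivity), Nat.cast_succ]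

lemma sum_block_inv_le {R : ℕ} (hR : 1 < R) (N j : ℕ) :
    ∑ k ∈ Finset.Icc 1 N with Nat.log R k = j, (k : ℝ)⁻¹ ≤ 2 * Real.log R := by
  calc ∑ k ∈ Finset.Icc 1 N with Nat.log R k = j, (k : ℝ)⁻¹
      ≤ ∑ k ∈ Finset.Ico (R ^ j) (R ^ (j + 1)), (k : ℝ)⁻¹ := by
        refine Finset.sum_le_sum_of_subset_of_nonneg (fun k hk => ?_) fun k _ _ => by positivity
        simp only [Finset.mem_filter, Finset.mem_Icc] at hk
        obtain ⟨⟨hk, -⟩, rfl⟩ := hk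
        exact Finset.mem_Ico.mpr
          ⟨Nat.pow_log_le_self R (by omega), Nat.lt_pow_succ_log_self hR k⟩
    _ ≤ ∑ k ∈ Finset.Ico (R ^ j) (R ^ (j + 1)),
          2 * (Real.log ((k + 1 : ℕ) : ℝ) - Real.log (k : ℝ)) := by
        refine Finset.sum_le_sum fun k hk => inv_le_two_mul_log_sub ?_
        exact (Nat.one_le_pow _ _ (by omega)).trans (Finset.mem_Ico.mp hk).1
    _ = 2 * Real.log R := by
        rw [← Finset.mul_sum, Finset.sum_Ico_sub (fun k : ℕ => Real.log (k : ℝ))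
          (Nat.pow_le_pow_right (by omega) j.le_succ)]
        push_cast
        rw [Real.log_pow, Real.log_pow]
        push_cast
        ring

lemma sum_block_le_mul_log {d : ℕ → ℝ} {N : ℕ} {B : ℝ} (hB : 0 ≤ B)
    (hd : ∀ k, 1 ≤ k → k ≤ N → d k ≤ B * (k : ℝ)⁻¹) {R : ℕ} (hR : 1 < R) (j : ℕ) :
    ∑ k ∈ Finset.Icc 1 N with Nat.log R k = j, d k ≤ B * (2 * Real.log R) := by
  calc ∑ k ∈ Finset.Icc 1 N with Nat.log R k = j, d k
      ≤ ∑ k ∈ Finset.Icc 1 N with Nat.log R k = j, B * (k : ℝ)⁻¹ :=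
        Finset.sum_le_sum fun k hk => by
          obtain ⟨hk₁, hkN⟩ := Finset.mem_Icc.mp (Finset.mem_filter.mp hk).1
          exact hd k hk₁ hkN
    _ ≤ B * (2 * Real.log R) := by
        rw [← Finset.mul_sum]
        gcongr
        exact sum_block_inv_le hR N j

lemma exists_blockRatio {β σ ε : ℝ} (hβ : 0 < β) (hσ : 0 < σ) (hε : 0 < ε) :
    ∃ c : ℝ, 0 < c ∧ ∀ L : ℝ, 1 ≤ L → ∃ R : ℕ, 1 < R ∧ (R : ℝ)⁻¹ ^ β ≤ L ^ (-σ) ∧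
      Real.log R ≤ c * L ^ ε := by
  let c := σ / β
  have hc : 0 < c := by positivity
  refine ⟨Real.log 3 + c / ε, by positivity, fun L hL => ⟨⌈L ^ c⌉₊ + 1, ?_, ?_, ?_⟩⟩
  · exact Nat.succ_lt_succ (Nat.ceil_pos.mpr (by positivity))
  · have hroot : L ^ σ = (L ^ c) ^ β := by
      rw [← Real.rpow_mul (by linarith), div_mul_cancel₀ _ hβ.ne']
    rw [Real.inv_rpow (by positivity), Real.rpow_neg (by linarith), hroot]
    gcongr
    push_cast
    linarith [Nat.le_ceil (L ^ c)]
  · have hLc : 1 ≤ L ^ c := Real.one_le_rpow hL hc.le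
    have hLε : 1 ≤ L ^ ε := Real.one_le_rpow hL hε.le
    calc Real.log ((⌈L ^ c⌉₊ + 1 : ℕ) : ℝ) ≤ Real.log (3 * L ^ c) := by
          gcongr
          push_cast
          linarith [(Nat.ceil_lt_add_one (by positivity : 0 ≤ L ^ c)).le]
      _ = Real.log 3 * 1 + c * Real.log L := by
          rw [Real.log_mul (by norm_num) (by positivity), Real.log_rpow (by linarith), mul_one]
      _ ≤ Real.log 3 * L ^ ε + c * (L ^ ε / ε) := by
          gcongr
          exact Real.log_le_rpow_div (by linarith) hε
      _ = (Real.log 3 + c / ε) * L ^ ε := by ring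

lemma tendsto_div_totalWeight {d : ℕ → ℝ} (hd : ∀ k, 1 ≤ k → 0 ≤ d k)
    (hD : Tendsto (totalWeight d) atTop atTop) {ρ : ℝ} (hρ : 0 < ρ)
    (hdD : d =O[atTop]
      (fun k : ℕ => totalWeight d k / ((k : ℝ) * (Real.log (totalWeight d k)) ^ ρ))) :
    Tendsto (fun n => d n / totalWeight d n) atTop (𝓝 0) := by
  obtain ⟨C, hC, hCd⟩ := exists_eventually_weight_le hd hD hρ hdD
  have hinv : Tendsto (fun n : ℕ => C * (n : ℝ)⁻¹) atTop (𝓝 0) := by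
    simpa using tendsto_inv_atTop_nhds_zero_nat.const_mul C
  refine squeeze_zero' ?_ ?_ hinv
  · filter_upwards [eventually_ge_atTop 1] with n hn
    exact div_nonneg (hd n hn) (totalWeight_nonneg hd n)
  · filter_upwards [hCd, hD.eventually_ge_atTop (Real.exp 1), eventually_ge_atTop 1]
      with n hn hexp hn₁
    have hD₀ : 0 < totalWeight d n := (Real.exp_pos 1).trans_le hexp
    have hlog : 1 ≤ Real.log (totalWeight d n) := (Real.le_log_iff_exp_le hD₀).mpr hexp
    rw [div_le_iff₀ hD₀, mul_right_comm]
    refine (hn n hn₁ le_rfl).trans ?_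
    gcongr
    exact div_le_self hD₀.le (Real.one_le_rpow hlog hρ.le)

lemma tendsto_totalWeight_succ_div {d : ℕ → ℝ} (hd : ∀ k, 1 ≤ k → 0 ≤ d k)
    (hD : Tendsto (totalWeight d) atTop atTop) {ρ : ℝ} (hρ : 0 < ρ)
    (hdD : d =O[atTop]
      (fun k : ℕ => totalWeight d k / ((k : ℝ) * (Real.log (totalWeight d k)) ^ ρ))) :
    Tendsto (fun n => totalWeight d (n + 1) / totalWeight d n) atTop (𝓝 1) := by
  have hfrac := tendsto_div_totalWeight hd hD hρ hdD
  have hinv : Tendsto (fun n => totalWeight d n / totalWeight d (n + 1)) atTop (𝓝 1) := by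
    have hone_sub := (hfrac.comp (tendsto_add_atTop_nat 1)).const_sub 1
    rw [sub_zero] at hone_sub
    refine hone_sub.congr' ?_
    filter_upwards [(tendsto_add_atTop_nat 1).eventually (hD.eventually_gt_atTop 0)] with n hn
    have hsucc : totalWeight d (n + 1) = totalWeight d n + d (n + 1) :=
      Finset.sum_Icc_succ_top (by omega) _
    rw [Function.comp_apply, one_sub_div hn.ne']
    congr 1
    linarith
  simpa using hinv.inv₀ one_ne_zero

end Weights

section WeightedDeviation

variable {Ω : Type*} [MeasurableSpace Ω] {P : Measure Ω} [IsProbabilityMeasure P]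
  {X : ℕ → Ω → ℝ} {a b d : ℕ → ℝ} {p : ℝ≥0}

-- The block ratio is a power of `log D_N`: large enough for the truncation error to be
-- negligible, while its logarithm, which enters the weight of a block, stays of smaller order.
lemma exists_eventually_lpNorm_sum_centered_le (hX : ∀ i, Measurable (X i))
    (hind : iIndepFun X P) (ha : ∀ n, 1 ≤ n → 0 < a n) {C β : ℝ} (hC : 0 ≤ C) (hβ : 0 < β)
    (hab : ∀ k l : ℕ, 1 ≤ k → k ≤ l → a k / a l ≤ C * ((k : ℝ) / (l : ℝ)) ^ β)
    (hp : 2 ≤ p) (hLp : ∀ k, MemLp (normSum X a b k) p P) {M : ℝ}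
    (hM : ∀ k, 1 ≤ k → lpNorm (normSum X a b k) p P ≤ M)
    (hd : ∀ k, 1 ≤ k → 0 ≤ d k) (hD : Tendsto (totalWeight d) atTop atTop)
    {ρ : ℝ} (hρ : 0 < ρ) (hdD : d =O[atTop]
      (fun k : ℕ => totalWeight d k / ((k : ℝ) * (Real.log (totalWeight d k)) ^ ρ)))
    {f : ℝ → ℝ} {K : ℝ≥0} (hf : LipschitzWith K f) {σ : ℝ} (hσ : 0 < σ) (hσρ : 2 * σ < ρ) :
    ∃ A : ℝ, 0 ≤ A ∧ ∀ᶠ N in atTop, lpNorm (fun ω =>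
        ∑ k ∈ Finset.Icc 1 N, d k * centered P (fun ω => f (normSum X a b k ω)) ω) p P
      ≤ A * (totalWeight d N * Real.log (totalWeight d N) ^ (-σ)) := by
  obtain ⟨B, hB, hBd⟩ := exists_eventually_weight_le hd hD hρ hdD
  obtain ⟨c, hc, hcR⟩ := exists_blockRatio hβ hσ (sub_pos.mpr hσρ)
  have hM₀ : 0 ≤ M := lpNorm_nonneg.trans (hM 1 le_rfl)
  refine ⟨2 * K * C * M + 4 * K * (1 + C) * M * √(smoothnessConst p * B * (2 * c)),
    by positivity, ?_⟩
  filter_upwards [hBd, hD.eventually_ge_atTop (Real.exp 1)] with N hN hexp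
  set D := totalWeight d N
  set L := Real.log D
  have hD₀ : 0 < D := (Real.exp_pos 1).trans_le hexp
  have hL : 1 ≤ L := (Real.le_log_iff_exp_le hD₀).mpr hexp
  have hL₀ : 0 < L := by linarith
  obtain ⟨R, hR, hRβ, hRlog⟩ := hcR L hL
  have hblock (j : ℕ) : ∑ k ∈ Finset.Icc 1 N with Nat.log R k = j, d k
      ≤ B * (D / L ^ ρ) * (2 * (c * L ^ (ρ - 2 * σ))) :=
    (sum_block_le_mul_log (by positivity) hN hR j).trans (by gcongr)
  have hsqrt : √(smoothnessConst p * (B * (D / L ^ ρ) * (2 * (c * L ^ (ρ - 2 * σ)))) * D)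
      = √(smoothnessConst p * B * (2 * c)) * (D * L ^ (-σ)) := by
    have hpow : L ^ (ρ - 2 * σ) / L ^ ρ = (L ^ (-σ)) ^ 2 := by
      rw [← Real.rpow_sub hL₀, ← Real.rpow_mul_natCast hL₀.le]
      congr 1; push_cast; ring
    rw [← Real.sqrt_sq (show 0 ≤ D * L ^ (-σ) by positivity), ← Real.sqrt_mul
      (by have := smoothnessConst_nonneg p; positivity), mul_pow, ← hpow]
    congr 1
    ring
  refine (lpNorm_sum_centered_le hX hind ha hC hβ.le hab hp hLp hM hd hf hR N hblock).trans ?_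
  rw [hsqrt, add_mul, mul_assoc _ √_]
  gcongr

end WeightedDeviation

section Subsequence

lemma exists_tendsto_le_lt_succ {c : ℕ → ℕ} (hc : Tendsto c atTop atTop) :
    ∃ J : ℕ → ℕ, Tendsto J atTop atTop ∧ ∀ᶠ N in atTop, c (J N) ≤ N ∧ N < c (J N + 1) := by
  have hex (N : ℕ) : ∃ j, N < c j := (hc.eventually_gt_atTop N).exists
  have hfind : Tendsto (fun N => Nat.find (hex N)) atTop atTop := by
    refine tendsto_atTop.mpr fun m => ?_
    filter_upwards [(Filter.eventually_all_finset (Finset.range m)).mpr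
      fun i _ => eventually_ge_atTop (c i)] with N hN
    exact (Nat.le_find_iff _ _).mpr fun i hi => not_lt.mpr (hN i (Finset.mem_range.mpr hi))
  refine ⟨fun N => Nat.find (hex N) - 1, (tendsto_sub_atTop_nat 1).comp hfind, ?_⟩
  filter_upwards [hfind.eventually_ge_atTop 1] with N hN
  refine ⟨not_lt.mp (Nat.find_min (hex N) (by omega)), ?_⟩
  rw [Nat.sub_add_cancel hN]
  exact Nat.find_spec (hex N)

lemma tendsto_div_of_monotone_of_subseq {u D : ℕ → ℝ} (hu : Monotone u) (hu₀ : ∀ n, 0 ≤ u n)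
    (hD : Monotone D) (hD₀ : ∀ᶠ n in atTop, 0 < D n) {c : ℕ → ℕ} (hc : Tendsto c atTop atTop)
    (hratio : Tendsto (fun j => D (c (j + 1)) / D (c j)) atTop (𝓝 1)) {l : ℝ}
    (hlim : Tendsto (fun j => u (c j) / D (c j)) atTop (𝓝 l)) :
    Tendsto (fun N => u N / D N) atTop (𝓝 l) := by
  obtain ⟨J, hJ, hJN⟩ := exists_tendsto_le_lt_succ hc
  have hlower : Tendsto (fun j => u (c j) / D (c j) / (D (c (j + 1)) / D (c j))) atTop (𝓝 l) := by
    simpa [Pi.div_def] using hlim.div hratio one_ne_zero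
  have hupper : Tendsto (fun j => u (c (j + 1)) / D (c (j + 1)) * (D (c (j + 1)) / D (c j)))
      atTop (𝓝 l) := by
    simpa using (hlim.comp (tendsto_add_atTop_nat 1)).mul hratio
  have hpos : ∀ᶠ N in atTop, 0 < D (c (J N)) := (hc.comp hJ).eventually hD₀
  refine tendsto_of_tendsto_of_tendsto_of_le_of_le' (hlower.comp hJ) (hupper.comp hJ) ?_ ?_
  · filter_upwards [hJN, hpos, hD₀] with N ⟨hle, hlt⟩ hcJ hN
    rw [Function.comp_apply, div_div_div_cancel_right₀ hcJ.ne']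
    exact div_le_div₀ (hu₀ N) (hu hle) hN (hD hlt.le)
  · filter_upwards [hJN, hpos, hD₀] with N ⟨hle, hlt⟩ hcJ hN
    rw [Function.comp_apply, div_mul_div_cancel₀ (hN.trans_le (hD hlt.le)).ne']
    exact div_le_div₀ (hu₀ _) (hu hlt.le) hcJ (hD hle)

lemma tendsto_rpow_succ_sub {γ : ℝ} (hγ₀ : 0 ≤ γ) (hγ₁ : γ < 1) :
    Tendsto (fun j : ℕ => ((j + 1 : ℕ) : ℝ) ^ γ - (j : ℝ) ^ γ) atTop (𝓝 0) := by
  have hlim : Tendsto (fun j : ℕ => γ * (j : ℝ) ^ (-(1 - γ))) atTop (𝓝 0) := by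
    simpa using ((tendsto_rpow_neg_atTop (by linarith : 0 < 1 - γ)).comp
      tendsto_natCast_atTop_atTop).const_mul γ
  refine squeeze_zero' (Eventually.of_forall fun j => ?_) ?_ hlim
  · rw [sub_nonneg]
    gcongr
    exact j.le_succ
  · filter_upwards [eventually_gt_atTop 0] with j hj
    have hj₀ : (0 : ℝ) < j := mod_cast hj
    have hsucc : ((j + 1 : ℕ) : ℝ) = j * (1 + (j : ℝ)⁻¹) := by push_cast; field_simp
    rw [hsucc, Real.mul_rpow hj₀.le (by positivity), neg_sub, Real.rpow_sub hj₀, Real.rpow_one]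
    calc (j : ℝ) ^ γ * (1 + (j : ℝ)⁻¹) ^ γ - (j : ℝ) ^ γ
        ≤ (j : ℝ) ^ γ * (1 + γ * (j : ℝ)⁻¹) - (j : ℝ) ^ γ := by
          gcongr
          exact rpow_one_add_le_one_add_mul_self (by linarith [inv_pos.mpr hj₀]) hγ₀ hγ₁.le
      _ = γ * ((j : ℝ) ^ γ / j) := by ring

lemma exists_subseq_le_of_tendsto_ratio {D : ℕ → ℝ} (hD : Monotone D)
    (hDtop : Tendsto D atTop atTop) (hDratio : Tendsto (fun n => D (n + 1) / D n) atTop (𝓝 1))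
    {t : ℕ → ℝ} (ht : Monotone t) (ht₀ : ∀ j, 0 < t j) (httop : Tendsto t atTop atTop)
    (htratio : Tendsto (fun j => t (j + 1) / t j) atTop (𝓝 1)) :
    ∃ c : ℕ → ℕ, Tendsto c atTop atTop ∧ (∀ j, t j ≤ D (c j)) ∧
      Tendsto (fun j => D (c (j + 1)) / D (c j)) atTop (𝓝 1) := by
  have hex (j : ℕ) : ∃ N, t j ≤ D N := (hDtop.eventually_ge_atTop _).exists
  let c (j : ℕ) := Nat.find (hex j)
  have htc (j : ℕ) : t j ≤ D (c j) := Nat.find_spec (hex j)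
  have hDc (j : ℕ) : 0 < D (c j) := (ht₀ j).trans_le (htc j)
  have hc : Tendsto c atTop atTop := by
    refine tendsto_atTop.mpr fun m => ?_
    filter_upwards [(tendsto_atTop_mono htc httop).eventually_gt_atTop (D m)] with j hj
    exact (hD.reflect_lt hj).le
  have hpred : Tendsto (fun j => c (j + 1) - 1) atTop atTop :=
    (tendsto_sub_atTop_nat 1).comp (hc.comp (tendsto_add_atTop_nat 1))
  refine ⟨c, hc, htc, tendsto_of_tendsto_of_tendsto_of_le_of_le' tendsto_const_nhds
    (by simpa [Function.comp_def] using (hDratio.comp hpred).mul htratio)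
    (Eventually.of_forall fun j => ?_) ?_⟩
  · exact (one_le_div (hDc j)).mpr (hD (Nat.find_mono fun _ h => (ht j.le_succ).trans h))
  · filter_upwards [hpred.eventually (hDtop.eventually_gt_atTop 0),
      (hc.comp (tendsto_add_atTop_nat 1)).eventually_ge_atTop 1] with j hj (hc₁ : 1 ≤ c (j + 1))
    have hlt : D (c (j + 1) - 1) ≤ t (j + 1) :=
      (not_le.mp (Nat.find_min (hex (j + 1)) (Nat.sub_lt hc₁ one_pos))).le
    simp only [Nat.sub_add_cancel hc₁]
    calc D (c (j + 1)) / D (c j) ≤ D (c (j + 1)) / t j :=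
          div_le_div_of_nonneg_left (hDc _).le (ht₀ j) (htc j)
      _ = D (c (j + 1)) / t (j + 1) * (t (j + 1) / t j) :=
          (div_mul_div_cancel₀ (ht₀ (j + 1)).ne').symm
      _ ≤ D (c (j + 1)) / D (c (j + 1) - 1) * (t (j + 1) / t j) := by
          gcongr
          · exact (div_pos (ht₀ _) (ht₀ j)).le
          · exact (hDc _).le

lemma exists_subseq_exp_rpow_le {D : ℕ → ℝ} (hD : Monotone D) (hDtop : Tendsto D atTop atTop)
    (hDratio : Tendsto (fun n => D (n + 1) / D n) atTop (𝓝 1)) {γ : ℝ} (hγ₀ : 0 < γ)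
    (hγ₁ : γ < 1) :
    ∃ c : ℕ → ℕ, Tendsto c atTop atTop ∧ (∀ j : ℕ, Real.exp ((j : ℝ) ^ γ) ≤ D (c j)) ∧
      Tendsto (fun j => D (c (j + 1)) / D (c j)) atTop (𝓝 1) := by
  refine exists_subseq_le_of_tendsto_ratio hD hDtop hDratio (t := fun j => Real.exp ((j : ℝ) ^ γ))
    (fun i j hij => ?_) (fun j => Real.exp_pos _)
    (Real.tendsto_exp_atTop.comp ((tendsto_rpow_atTop hγ₀).comp tendsto_natCast_atTop_atTop)) ?_
  · exact Real.exp_le_exp.mpr (by gcongr)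
  · simpa only [Function.comp_def, Real.exp_sub, Real.exp_zero] using
      (Real.continuous_exp.tendsto 0).comp (tendsto_rpow_succ_sub hγ₀.le hγ₁)

end Subsequence

section AlmostSure

lemma tendsto_weighted_average {d e : ℕ → ℝ} (hd : ∀ k, 1 ≤ k → 0 ≤ d k)
    (hD : Tendsto (totalWeight d) atTop atTop) {l : ℝ} (he : Tendsto e atTop (𝓝 l)) :
    Tendsto (fun N => (∑ k ∈ Finset.Icc 1 N, d k * e k) / totalWeight d N) atTop (𝓝 l) := by
  have hIcc (g : ℕ → ℝ) (N : ℕ) :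
      ∑ k ∈ Finset.range N, g (k + 1) = ∑ k ∈ Finset.Icc 1 N, g k := by
    rw [Finset.range_eq_Ico, Finset.sum_Ico_add' g 0 N 1]
    rfl
  have hlittle : (fun k => d (k + 1) * (e (k + 1) - l)) =o[atTop] fun k => d (k + 1) := by
    have he' : (fun k => e (k + 1) - l) =o[atTop] fun _ => (1 : ℝ) := by
      rw [isLittleO_one_iff]
      simpa using (he.comp (tendsto_add_atTop_nat 1)).sub_const l
    simpa using (isBigO_refl (fun k => d (k + 1)) atTop).mul_isLittleO he'
  have hsum := hlittle.sum_range (fun k => hd (k + 1) (by omega))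
    (hD.congr fun N => (hIcc d N).symm)
  simp only [hIcc d, hIcc fun k => d k * (e k - l)] at hsum
  have hadd := hsum.tendsto_div_nhds_zero.add_const l
  rw [zero_add] at hadd
  refine hadd.congr' ?_
  filter_upwards [hD.eventually_gt_atTop 0] with N hN
  have hsub : ∑ k ∈ Finset.Icc 1 N, d k * (e k - l)
      = ∑ k ∈ Finset.Icc 1 N, d k * e k - totalWeight d N * l := by
    simp only [mul_sub, Finset.sum_sub_distrib, ← Finset.sum_mul, totalWeight]
  change _ / totalWeight d N + l = _
  rw [hsub, sub_div, mul_div_cancel_left₀ _ hN.ne', sub_add_cancel]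

variable {Ω : Type*} [MeasurableSpace Ω] {P : Measure Ω} {p : ℝ≥0}

lemma ae_tendsto_zero_of_summable_lpNorm_rpow (hp : p ≠ 0) {g : ℕ → Ω → ℝ}
    (hg : ∀ j, MemLp (g j) p P) (hsum : Summable fun j => lpNorm (g j) p P ^ (p : ℝ)) :
    ∀ᵐ ω ∂P, Tendsto (fun j => g j ω) atTop (𝓝 0) := by
  have hnorm (j : ℕ) :
      ∫⁻ ω, ‖g j ω‖ₑ ^ (p : ℝ) ∂P = ENNReal.ofReal (lpNorm (g j) p P ^ (p : ℝ)) := by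
    rw [← eLpNorm_nnreal_pow_eq_lintegral hp, ← ofReal_lpNorm (hg j)]
    exact ENNReal.ofReal_rpow_of_nonneg lpNorm_nonneg p.coe_nonneg
  have hmeas (j : ℕ) : AEMeasurable (fun ω => ‖g j ω‖ₑ ^ (p : ℝ)) P := (hg j).1.enorm.pow_const _
  have hfin : ∫⁻ ω, ∑' j, ‖g j ω‖ₑ ^ (p : ℝ) ∂P ≠ ∞ := by
    rw [lintegral_tsum hmeas]
    simp only [hnorm]
    exact hsum.tsum_ofReal_ne_top
  filter_upwards [ae_lt_top' (AEMeasurable.tsum hmeas) hfin] with ω hω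
  have hroot := (ENNReal.tendsto_atTop_zero_of_tsum_ne_top hω.ne).ennrpow_const (p : ℝ)⁻¹
  have hp' : 0 < (p : ℝ) := NNReal.coe_pos.mpr (pos_iff_ne_zero.mpr hp)
  simp only [ENNReal.rpow_rpow_inv hp'.ne', ENNReal.zero_rpow_of_pos (inv_pos.mpr hp')] at hroot
  exact tendsto_zero_iff_enorm_tendsto_zero.mpr hroot

lemma ae_tendsto_div_zero_of_lpNorm_le (hp : p ≠ 0) {S : ℕ → Ω → ℝ} (hS : ∀ N, MemLp (S N) p P)
    {D : ℕ → ℝ} {A σ : ℝ} (hA : 0 ≤ A) (hσ : 0 ≤ σ)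
    (hSD : ∀ᶠ N in atTop, lpNorm (S N) p P ≤ A * (D N * Real.log (D N) ^ (-σ)))
    {c : ℕ → ℕ} (hc : Tendsto c atTop atTop) {γ : ℝ}
    (hcD : ∀ j : ℕ, Real.exp ((j : ℝ) ^ γ) ≤ D (c j)) (hγ : 1 < γ * σ * p) :
    ∀ᵐ ω ∂P, Tendsto (fun j => S (c j) ω / D (c j)) atTop (𝓝 0) := by
  have hbound : ∀ᶠ j : ℕ in atTop,
      lpNorm (fun ω => S (c j) ω / D (c j)) p P ≤ A * (j : ℝ) ^ (-(γ * σ)) := by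
    filter_upwards [hc.eventually hSD, eventually_gt_atTop 0] with j hj hj₀
    have hj₀' : (0 : ℝ) < j := mod_cast hj₀
    have hD₀ : 0 < D (c j) := (Real.exp_pos _).trans_le (hcD j)
    have hlog : (j : ℝ) ^ γ ≤ Real.log (D (c j)) := (Real.le_log_iff_exp_le hD₀).mpr (hcD j)
    have hscale : (fun ω => S (c j) ω / D (c j)) = (D (c j))⁻¹ • S (c j) := by
      ext ω
      simp [div_eq_inv_mul]
    rw [hscale, lpNorm_const_smul, coe_nnnorm, Real.norm_of_nonneg (by positivity),
      inv_mul_le_iff₀ hD₀]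
    calc lpNorm (S (c j)) p P ≤ A * (D (c j) * Real.log (D (c j)) ^ (-σ)) := hj
      _ ≤ A * (D (c j) * ((j : ℝ) ^ γ) ^ (-σ)) := by
          gcongr A * (D (c j) * ?_)
          exact Real.rpow_le_rpow_of_nonpos (by positivity) hlog (by linarith)
      _ = D (c j) * (A * (j : ℝ) ^ (-(γ * σ))) := by
          rw [← Real.rpow_mul hj₀'.le, mul_neg]
          ring
  have hsummable : Summable fun j : ℕ => (A * (j : ℝ) ^ (-(γ * σ))) ^ (p : ℝ) := by
    refine ((Real.summable_nat_rpow (p := -(γ * σ * p))).mpr (by linarith)).mul_left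
      (A ^ (p : ℝ)) |>.congr fun j => ?_
    rw [Real.mul_rpow hA (by positivity), ← Real.rpow_mul j.cast_nonneg, neg_mul]
  refine ae_tendsto_zero_of_summable_lpNorm_rpow hp (fun j => ?_)
    (hsummable.of_norm_bounded_eventually_nat ?_)
  · simpa only [div_eq_mul_inv] using (hS (c j)).mul_const _
  · filter_upwards [hbound] with j hj
    have hroot := lpNorm_nonneg (f := fun ω => S (c j) ω / D (c j)) (p := p) (μ := P)
    rw [Real.norm_of_nonneg (by positivity)]
    gcongr

variable [IsProbabilityMeasure P]

lemma ae_tendsto_weighted_average_of_lpNorm_centered_le (hp : 1 ≤ p) {Y : ℕ → Ω → ℝ}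
    (hY₀ : ∀ k ω, 0 ≤ Y k ω) (hY : ∀ k, MemLp (Y k) p P) {l : ℝ}
    (hmean : Tendsto (fun k => ∫ ω, Y k ω ∂P) atTop (𝓝 l)) {d : ℕ → ℝ}
    (hd : ∀ k, 1 ≤ k → 0 ≤ d k) (hD : Tendsto (totalWeight d) atTop atTop)
    (hratio : Tendsto (fun n => totalWeight d (n + 1) / totalWeight d n) atTop (𝓝 1))
    {A σ : ℝ} (hA : 0 ≤ A) (hσ : 1 < σ * p)
    (hdev : ∀ᶠ N in atTop, lpNorm (fun ω => ∑ k ∈ Finset.Icc 1 N, d k * centered P (Y k) ω) p P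
      ≤ A * (totalWeight d N * Real.log (totalWeight d N) ^ (-σ))) :
    ∀ᵐ ω ∂P, Tendsto (fun N => (∑ k ∈ Finset.Icc 1 N, d k * Y k ω) / totalWeight d N)
      atTop (𝓝 l) := by
  have hp₀ : p ≠ 0 := (zero_lt_one.trans_le hp).ne'
  have hσ₀ : 0 < σ := pos_of_mul_pos_left (zero_lt_one.trans hσ) p.coe_nonneg
  obtain ⟨γ, hγσ, hγ₁⟩ := exists_between (inv_lt_one_of_one_lt₀ hσ)
  have hγ₀ : 0 < γ := (inv_pos.mpr (zero_lt_one.trans hσ)).trans hγσ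
  have hγσp : 1 < γ * σ * p := by
    rwa [mul_assoc, ← inv_lt_iff_one_lt_mul₀ (zero_lt_one.trans hσ)]
  obtain ⟨c, hc, hcD, hcratio⟩ :=
    exists_subseq_exp_rpow_le (totalWeight_mono hd) hD hratio hγ₀ hγ₁
  have hfluct := ae_tendsto_div_zero_of_lpNorm_le hp₀
    (fun N => memLp_finsetSum _ fun k _ => (memLp_centered (hY k)).const_mul (d k)) hA hσ₀.le
    hdev hc hcD hγσp
  have hterm (ω : Ω) {k N : ℕ} (hk : k ∈ Finset.Icc 1 N) : 0 ≤ d k * Y k ω :=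
    mul_nonneg (hd k (Finset.mem_Icc.mp hk).1) (hY₀ k ω)
  filter_upwards [hfluct] with ω hω
  refine tendsto_div_of_monotone_of_subseq
    (fun m n hmn => Finset.sum_le_sum_of_subset_of_nonneg (Finset.Icc_subset_Icc_right hmn)
      fun k hk _ => hterm ω hk)
    (fun n => Finset.sum_nonneg fun k hk => hterm ω hk)
    (totalWeight_mono hd) (hD.eventually_gt_atTop 0) hc hcratio ?_
  have hsum := hω.add ((tendsto_weighted_average hd hD hmean).comp hc)
  rw [zero_add] at hsum
  refine hsum.congr fun j => ?_
  rw [Function.comp_apply, ← add_div, ← Finset.sum_add_distrib]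
  simp only [centered, ← mul_add, sub_add_cancel]

end AlmostSure

section WeakConvergence

lemma integrable_comp_of_abs_le_mul_add {Ω E : Type*} [MeasurableSpace Ω] {P : Measure Ω}
    [IsFiniteMeasure P] [MeasurableSpace E] {f h : E → ℝ} (hf : Measurable f)
    (hfh : ∀ ε > 0, ∃ c : ℝ, ∀ x, |f x| ≤ ε * h x + c) {Y : Ω → E} (hY : AEMeasurable Y P)
    (hint : Integrable (fun ω => h (Y ω)) P) : Integrable (fun ω => f (Y ω)) P := by
  obtain ⟨c, hc⟩ := hfh 1 one_pos
  exact ((hint.const_mul 1).add (integrable_const c)).mono'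
    (hf.comp_aemeasurable hY).aestronglyMeasurable (ae_of_all _ fun ω => hc (Y ω))

lemma integral_add_const_mul_add_const {Ω : Type*} [MeasurableSpace Ω] {P : Measure Ω}
    [IsProbabilityMeasure P] {u v : Ω → ℝ} (hu : Integrable u P) (hv : Integrable v P) (ε c : ℝ) :
    ∫ ω, (u ω + ε * v ω + c) ∂P = ∫ ω, u ω ∂P + ε * ∫ ω, v ω ∂P + c := by
  have hadd := integral_add (hu.add (hv.const_mul ε)) (integrable_const c)
  simpa [integral_add hu (hv.const_mul ε), integral_const_mul] using hadd

variable {Ω E : Type*} [MeasurableSpace Ω] {P : Measure Ω} [IsProbabilityMeasure P]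
  [TopologicalSpace E] [HasOuterApproxClosed E] [MeasurableSpace E] [BorelSpace E]
  {H : Measure E} [IsProbabilityMeasure H] {Z : ℕ → Ω → E} {f h : E → ℝ} {M : ℝ}

lemma lintegral_le_liminf_of_tendstoInDistribution
    (hZ : TendstoInDistribution Z atTop (id : E → E) (fun _ => P) H) (hh : Continuous h)
    (hh₀ : ∀ x, 0 ≤ h x) :
    ∫⁻ x, ENNReal.ofReal (h x) ∂H
      ≤ liminf (fun n => ∫⁻ ω, ENNReal.ofReal (h (Z n ω)) ∂P) atTop := by
  have hfatou := lintegral_le_liminf_lintegral_of_forall_isOpen_measure_le_liminf_measure hh hh₀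
    fun _ hG => ProbabilityMeasure.le_liminf_measure_open_of_tendsto hZ.tendsto hG
  have hmap (n : ℕ) : ∫⁻ x, ENNReal.ofReal (h x) ∂(P.map (Z n))
      = ∫⁻ ω, ENNReal.ofReal (h (Z n ω)) ∂P :=
    lintegral_map' hh.measurable.ennreal_ofReal.aemeasurable (hZ.forall_aemeasurable n)
  simpa only [ProbabilityMeasure.coe_mk, Measure.map_id, hmap] using hfatou

lemma integrable_and_integral_le_of_frequently
    (hZ : TendstoInDistribution Z atTop (id : E → E) (fun _ => P) H) (hh : Continuous h)
    (hh₀ : ∀ x, 0 ≤ h x)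
    (hM : ∃ᶠ n in atTop, Integrable (fun ω => h (Z n ω)) P ∧ ∫ ω, h (Z n ω) ∂P ≤ M) :
    Integrable h H ∧ ∫ x, h x ∂H ≤ M := by
  have hM₀ : 0 ≤ M := by
    obtain ⟨n, -, hn⟩ := hM.exists
    exact (integral_nonneg fun ω => hh₀ (Z n ω)).trans hn
  have hle : ∫⁻ x, ENNReal.ofReal (h x) ∂H ≤ ENNReal.ofReal M := by
    refine (lintegral_le_liminf_of_tendstoInDistribution hZ hh hh₀).trans
      (liminf_le_of_frequently_le' (hM.mono fun n hn => ?_))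
    rw [← ofReal_integral_eq_lintegral_ofReal hn.1 (ae_of_all _ fun ω => hh₀ _)]
    exact ENNReal.ofReal_le_ofReal hn.2
  have hint : Integrable h H := (lintegral_ofReal_ne_top_iff_integrable
    hh.aestronglyMeasurable (ae_of_all _ hh₀)).mp (hle.trans_lt ENNReal.ofReal_lt_top).ne
  rw [← ofReal_integral_eq_lintegral_ofReal hint (ae_of_all _ hh₀)] at hle
  exact ⟨hint, (ENNReal.ofReal_le_ofReal_iff hM₀).mp hle⟩

-- Fatou's lemma applies to the nonnegative function `f + ε h + c`, whose `ε`-term is uniformly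
-- small in mean.
lemma eventually_integral_sub_lt_integral
    (hZ : TendstoInDistribution Z atTop (id : E → E) (fun _ => P) H) (hh : Continuous h)
    (hh₀ : ∀ x, 0 ≤ h x)
    (hM : ∀ᶠ n in atTop, Integrable (fun ω => h (Z n ω)) P ∧ ∫ ω, h (Z n ω) ∂P ≤ M)
    (hf : Continuous f) (hfh : ∀ ε > 0, ∃ c : ℝ, ∀ x, |f x| ≤ ε * h x + c)
    {η : ℝ} (hη : 0 < η) :
    ∀ᶠ n in atTop, ∫ x, f x ∂H - η < ∫ ω, f (Z n ω) ∂P := by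
  obtain ⟨hHh, hHM⟩ := integrable_and_integral_le_of_frequently hZ hh hh₀ hM.frequently
  have hHf : Integrable f H :=
    integrable_comp_of_abs_le_mul_add hf.measurable hfh aemeasurable_id hHh
  have hH₀ : 0 ≤ ∫ x, h x ∂H := integral_nonneg hh₀
  have hM₁ : 0 < M + 1 := by linarith
  set ε := η / (M + 1)
  have hε : 0 < ε := div_pos hη hM₁
  obtain ⟨c, hc⟩ := hfh ε hε
  by_contra hcon
  have hfreq : ∃ᶠ n in atTop, Integrable (fun ω => f (Z n ω) + ε * h (Z n ω) + c) P ∧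
      ∫ ω, (f (Z n ω) + ε * h (Z n ω) + c) ∂P ≤ ∫ x, f x ∂H - η + ε * M + c := by
    refine ((not_eventually.mp hcon).and_eventually hM).mono fun n ⟨hn, hint, hle⟩ => ?_
    have hintf : Integrable (fun ω => f (Z n ω)) P :=
      integrable_comp_of_abs_le_mul_add hf.measurable hfh (hZ.forall_aemeasurable n) hint
    refine ⟨(hintf.add (hint.const_mul ε)).add (integrable_const c), ?_⟩
    rw [integral_add_const_mul_add_const hintf hint]
    gcongr
    exact not_lt.mp hn
  have hlim := (integrable_and_integral_le_of_frequently hZ (h := fun x => f x + ε * h x + c)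
    (by fun_prop) (fun x => by linarith [neg_abs_le (f x), hc x]) hfreq).2
  rw [integral_add_const_mul_add_const hHf hHh] at hlim
  have hεM : ε * (M + 1) = η := div_mul_cancel₀ η hM₁.ne'
  linarith [mul_nonneg hε.le hH₀]

lemma integrable_and_tendsto_integral_of_abs_le_mul_add
    (hZ : TendstoInDistribution Z atTop (id : E → E) (fun _ => P) H) (hh : Continuous h)
    (hh₀ : ∀ x, 0 ≤ h x)
    (hM : ∀ᶠ n in atTop, Integrable (fun ω => h (Z n ω)) P ∧ ∫ ω, h (Z n ω) ∂P ≤ M)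
    (hf : Continuous f) (hfh : ∀ ε > 0, ∃ c : ℝ, ∀ x, |f x| ≤ ε * h x + c) :
    Integrable f H ∧ Tendsto (fun n => ∫ ω, f (Z n ω) ∂P) atTop (𝓝 (∫ x, f x ∂H)) := by
  have hHh := (integrable_and_integral_le_of_frequently hZ hh hh₀ hM.frequently).1
  refine ⟨integrable_comp_of_abs_le_mul_add hf.measurable hfh aemeasurable_id hHh,
    tendsto_order.mpr ⟨fun t ht => ?_, fun t ht => ?_⟩⟩
  · filter_upwards [eventually_integral_sub_lt_integral hZ hh hh₀ hM hf hfh (sub_pos.mpr ht)]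
      with n hn
    linarith
  · filter_upwards [eventually_integral_sub_lt_integral hZ hh hh₀ hM hf.neg
      (by simpa only [Pi.neg_apply, abs_neg] using hfh) (sub_pos.mpr ht)] with n hn
    simp only [Pi.neg_apply, integral_neg] at hn
    linarith

lemma exists_abs_le_mul_sq_add_of_lipschitzWith {f : ℝ → ℝ} {K : ℝ≥0} (hf : LipschitzWith K f)
    {ε : ℝ} (hε : 0 < ε) : ∃ c : ℝ, ∀ x, |f x| ≤ ε * x ^ 2 + c := by
  refine ⟨|f 0| + K ^ 2 / (4 * ε), fun x => ?_⟩
  have hlip : |f x - f 0| ≤ K * |x| := by simpa [Real.dist_eq] using hf.dist_le_mul x 0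
  have hamgm : K * |x| ≤ ε * x ^ 2 + K ^ 2 / (4 * ε) := by
    have hsq : ε * |x| ^ 2 + K ^ 2 / (4 * ε) - K * |x| = (2 * ε * |x| - K) ^ 2 / (4 * ε) := by
      field_simp
      ring
    have hsq₀ : 0 ≤ (2 * ε * |x| - K) ^ 2 / (4 * ε) := by positivity
    rw [← sq_abs x]
    linarith
  linarith [abs_sub_abs_le_abs_sub (f x) (f 0)]

end WeakConvergence

section Moments

variable {Ω : Type*} [MeasurableSpace Ω] {P : Measure Ω} {p : ℝ≥0} {Y : Ω → ℝ} {M : ℝ≥0}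

lemma memLp_of_lintegral_enorm_rpow_le (hp : p ≠ 0) (hY : AEStronglyMeasurable Y P)
    (hM : ∫⁻ ω, ‖Y ω‖ₑ ^ (p : ℝ) ∂P ≤ M) : MemLp Y p P := by
  refine ⟨hY, (eLpNorm_lt_top_iff_lintegral_rpow_enorm_lt_top (mod_cast hp) (by simp)).mpr ?_⟩
  exact hM.trans_lt ENNReal.coe_lt_top

lemma lpNorm_le_of_lintegral_enorm_rpow_le (hp : p ≠ 0) (hY : AEStronglyMeasurable Y P)
    (hM : ∫⁻ ω, ‖Y ω‖ₑ ^ (p : ℝ) ∂P ≤ M) : lpNorm Y p P ≤ (M : ℝ) ^ (p : ℝ)⁻¹ := by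
  have hp' : 0 < (p : ℝ) := NNReal.coe_pos.mpr (pos_iff_ne_zero.mpr hp)
  rw [Real.le_rpow_inv_iff_of_pos lpNorm_nonneg M.coe_nonneg hp', ← toReal_eLpNorm hY,
    ENNReal.toReal_rpow, eLpNorm_nnreal_pow_eq_lintegral hp]
  exact ENNReal.toReal_le_coe_of_le_coe hM

lemma memLp_normSum [IsProbabilityMeasure P] {X : ℕ → Ω → ℝ} (hX : ∀ i, Measurable (X i))
    {a b : ℕ → ℝ} (hp : p ≠ 0)
    (hM : ∀ n, 1 ≤ n → ∫⁻ ω, ‖normSum X a b n ω‖ₑ ^ (p : ℝ) ∂P ≤ M) (n : ℕ) :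
    MemLp (normSum X a b n) p P := by
  rcases Nat.eq_zero_or_pos n with rfl | hn
  · have hconst : normSum X a b 0 = fun _ => -b 0 := by
      ext ω
      simp [normSum, partialSum]
    exact hconst ▸ memLp_const _
  · exact memLp_of_lintegral_enorm_rpow_le hp (measurable_normSum hX n).aestronglyMeasurable
      (hM n hn)

end Moments

section Lipschitz

variable {Ω : Type*} [MeasurableSpace Ω] {P : Measure Ω} [IsProbabilityMeasure P] {p : ℝ≥0}
  {f : ℝ → ℝ} {K : ℝ≥0} {M : ℝ}

lemma integrable_and_tendsto_integral_of_lipschitzWith {H : Measure ℝ} [IsProbabilityMeasure H]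
    {Z : ℕ → Ω → ℝ} (hZ : TendstoInDistribution Z atTop (id : ℝ → ℝ) (fun _ => P) H) (hp : 2 ≤ p)
    (hLp : ∀ n, MemLp (Z n) p P) (hM : ∀ᶠ n in atTop, lpNorm (Z n) p P ≤ M)
    (hf : LipschitzWith K f) :
    Integrable f H ∧ Tendsto (fun n => ∫ ω, f (Z n ω) ∂P) atTop (𝓝 (∫ x, f x ∂H)) := by
  have hsq : ∀ᶠ n in atTop, Integrable (fun ω => Z n ω ^ 2) P ∧ ∫ ω, Z n ω ^ 2 ∂P ≤ M ^ 2 := by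
    filter_upwards [hM] with n hn
    refine ⟨((hLp n).mono_exponent (mod_cast hp)).integrable_sq, ?_⟩
    calc ∫ ω, Z n ω ^ 2 ∂P ≤ lpNorm (Z n) p P ^ 2 := by
          simpa using integral_abs_rpow_le_lpNorm_rpow hp (hLp n)
      _ ≤ M ^ 2 := by
          gcongr
          exact lpNorm_nonneg
  exact integrable_and_tendsto_integral_of_abs_le_mul_add hZ (continuous_pow 2) sq_nonneg hsq
    hf.continuous fun _ hε => exists_abs_le_mul_sq_add_of_lipschitzWith hf hε

lemma ae_tendsto_weighted_average_of_nonneg {X : ℕ → Ω → ℝ} {a b d : ℕ → ℝ}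
    (hX : ∀ i, Measurable (X i)) (hind : iIndepFun X P) (ha : ∀ n, 1 ≤ n → 0 < a n)
    {C β : ℝ} (hC : 0 ≤ C) (hβ : 0 < β)
    (hab : ∀ k l : ℕ, 1 ≤ k → k ≤ l → a k / a l ≤ C * ((k : ℝ) / (l : ℝ)) ^ β)
    (hp : 2 ≤ p) (hLp : ∀ k, MemLp (normSum X a b k) p P)
    (hM : ∀ k, 1 ≤ k → lpNorm (normSum X a b k) p P ≤ M)
    (hd : ∀ k, 1 ≤ k → 0 ≤ d k) (hD : Tendsto (totalWeight d) atTop atTop)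
    {ρ : ℝ} (hρp : 2 < ρ * p) (hdD : d =O[atTop]
      (fun k : ℕ => totalWeight d k / ((k : ℝ) * (Real.log (totalWeight d k)) ^ ρ)))
    (hf : LipschitzWith K f) (hf₀ : ∀ x, 0 ≤ f x) {l : ℝ}
    (hmean : Tendsto (fun n => ∫ ω, f (normSum X a b n ω) ∂P) atTop (𝓝 l)) :
    ∀ᵐ ω ∂P, Tendsto
      (fun N : ℕ => (∑ k ∈ Finset.Icc 1 N, d k * f (normSum X a b k ω)) / totalWeight d N)
      atTop (𝓝 l) := by
  have hp₁ : 1 ≤ p := one_le_two.trans hp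
  have hp₀ : 0 < (p : ℝ) := NNReal.coe_pos.mpr (zero_lt_one.trans_le hp₁)
  have hρ : 0 < ρ := pos_of_mul_pos_left (two_pos.trans hρp) hp₀.le
  obtain ⟨σ, hpσ, hσρ⟩ : ∃ σ, (p : ℝ)⁻¹ < σ ∧ σ < ρ / 2 :=
    exists_between ((inv_lt_iff_one_lt_mul₀ hp₀).mpr (by linarith))
  have hσ₀ : 0 < σ := (inv_pos.mpr hp₀).trans hpσ
  obtain ⟨A, hA, hdev⟩ := exists_eventually_lpNorm_sum_centered_le hX hind ha hC hβ hab hp hLp hM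
    hd hD hρ hdD hf hσ₀ (by linarith : 2 * σ < ρ)
  exact ae_tendsto_weighted_average_of_lpNorm_centered_le hp₁ (fun _ _ => hf₀ _)
    (fun k => memLp_lipschitz_comp hf (hLp k)) hmean hd hD
    (tendsto_totalWeight_succ_div hd hD hρ hdD) hA ((inv_lt_iff_one_lt_mul₀ hp₀).mp hpσ) hdev

end Lipschitz

theorem theorem1_general {Ω : Type*} [MeasurableSpace Ω] (P : Measure Ω) [IsProbabilityMeasure P]
    (X : ℕ → Ω → ℝ) (hX : ∀ i, Measurable (X i)) (hind : iIndepFun X P)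
    (a b d : ℕ → ℝ) (ha : ∀ n, 1 ≤ n → 0 < a n)
    (hd : ∀ k, 1 ≤ k → 0 ≤ d k) (hD : Tendsto (totalWeight d) atTop atTop)
    (H : Measure ℝ) [IsProbabilityMeasure H]
    (hC1 : TendstoInDistribution (fun n => normSum X a b n) atTop (id : ℝ → ℝ) (fun _ => P) H)
    (ρ : ℝ) (hC3 : d =O[atTop]
      (fun k : ℕ => totalWeight d k / ((k : ℝ) * (Real.log (totalWeight d k)) ^ ρ)))
    (hC4 : ∃ C β : ℝ, 0 < C ∧ 0 < β ∧
      ∀ k l : ℕ, 1 ≤ k → k ≤ l → a k / a l ≤ C * ((k : ℝ) / (l : ℝ)) ^ β)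
    (p : ℝ≥0) (hp : 2 ≤ p) (hρp : 2 < ρ * p)
    (hmom : ∃ M : ℝ≥0, ∀ n, 1 ≤ n → ∫⁻ ω, ‖normSum X a b n ω‖ₑ ^ (p : ℝ) ∂P ≤ M)
    (f : ℝ → ℝ) (hf : ∃ K : ℝ≥0, LipschitzWith K f) :
    Integrable f H ∧
      ∀ᵐ ω ∂P, Tendsto
        (fun N : ℕ => (totalWeight d N)⁻¹ * ∑ k ∈ Finset.Icc 1 N, d k * f (normSum X a b k ω))
        atTop (𝓝 (∫ x, f x ∂H)) := by
  obtain ⟨C, β, hC, hβ, hab⟩ := hC4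
  obtain ⟨M, hM⟩ := hmom
  obtain ⟨K, hK⟩ := hf
  have hp₀ : p ≠ 0 := (two_pos.trans_le hp).ne'
  have hLp := memLp_normSum hX hp₀ hM
  have hnorm (n : ℕ) (hn : 1 ≤ n) : lpNorm (normSum X a b n) p P ≤ (M : ℝ) ^ (p : ℝ)⁻¹ :=
    lpNorm_le_of_lintegral_enorm_rpow_le hp₀ (measurable_normSum hX n).aestronglyMeasurable
      (hM n hn)
  have hlim {g : ℝ → ℝ} (hg : LipschitzWith K g) :=
    integrable_and_tendsto_integral_of_lipschitzWith hC1 hp hLp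
      ((eventually_ge_atTop 1).mono hnorm) hg
  have hpos : LipschitzWith K fun x => max (f x) 0 := hK.max_const 0
  have hneg : LipschitzWith K fun x => max (-f x) 0 := hK.neg.max_const 0
  refine ⟨(hlim hK).1, ?_⟩
  filter_upwards [ae_tendsto_weighted_average_of_nonneg hX hind ha hC.le hβ hab hp hLp hnorm hd hD
      hρp hC3 hpos (fun _ => le_max_right _ _) (hlim hpos).2,
    ae_tendsto_weighted_average_of_nonneg hX hind ha hC.le hβ hab hp hLp hnorm hd hD
      hρp hC3 hneg (fun _ => le_max_right _ _) (hlim hneg).2] with ω hωpos hωneg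
  simpa only [← integral_sub (hlim hpos).1 (hlim hneg).1, max_zero_sub_max_neg_zero_eq_self,
    ← sub_div, ← Finset.sum_sub_distrib, ← mul_sub, div_eq_inv_mul] using hωpos.sub hωneg

lemma two_lt_mul_of_max_le {ρ r x : ℝ} (hr : 0 < r) (hrρ : r < ρ)
    (hx : max 2 (4 / (ρ - r)) ≤ x) : 2 < ρ * x := by
  obtain ⟨hx₂, hx₄⟩ := max_le_iff.mp hx
  rw [div_le_iff₀ (sub_pos.mpr hrρ)] at hx₄
  linarith [mul_nonneg hr.le (zero_le_two.trans hx₂)]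

theorem theorem1 {Ω : Type*} [MeasurableSpace Ω] (P : Measure Ω) [IsProbabilityMeasure P]
    (X : ℕ → Ω → ℝ) (hX : ∀ i, Measurable (X i)) (hind : iIndepFun X P)
    (a b d : ℕ → ℝ) (ha : ∀ n, 1 ≤ n → 0 < a n)
    (hd : ∀ k, 1 ≤ k → 0 < d k) (hD : Tendsto (totalWeight d) atTop atTop)
    -- convergence in law to the distribution `H`
    (H : Measure ℝ) [IsProbabilityMeasure H]
    (hC1 : TendstoInDistribution (fun n => normSum X a b n) atTop (id : ℝ → ℝ) (fun _ => P) H)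
    -- size and monotonicity of the weights
    (hC2 : (fun k : ℕ => (k : ℝ) * d k) =O[atTop] (fun _ => (1 : ℝ)) ∨
      (fun k : ℕ => ((k : ℝ) * d k)⁻¹) =O[atTop] (fun _ => (1 : ℝ)))
    (hC2' : ∃ α : ℝ, 0 < α ∧ α < 1 ∧
      ∃ k₀ : ℕ, AntitoneOn (fun k : ℕ => d k * (k : ℝ) ^ α) (Set.Ici k₀))
    (ρ : ℝ) (hρ : 0 < ρ)
    (hC3 : d =O[atTop]
      (fun k : ℕ => totalWeight d k / ((k : ℝ) * (Real.log (totalWeight d k)) ^ ρ)))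
    -- growth of the normalization and bounded moments
    (hC4 : ∃ C β : ℝ, 0 < C ∧ 0 < β ∧
      ∀ k l : ℕ, 1 ≤ k → k ≤ l → a k / a l ≤ C * ((k : ℝ) / (l : ℝ)) ^ β)
    (r : ℝ) (hr : 0 < r) (hrρ : r < ρ)
    (μ : ℕ) (hμ : max 2 (4 / (ρ - r)) ≤ (μ : ℝ))
    (hmom : ∃ M : ℝ≥0, ∀ n, 1 ≤ n → ∫⁻ ω, ‖normSum X a b n ω‖ₑ ^ μ ∂P ≤ M)
    (f : ℝ → ℝ) (hf : ∃ K : ℝ≥0, LipschitzWith K f) :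
    Integrable f H ∧
      ∀ᵐ ω ∂P, Tendsto
        (fun N : ℕ => (totalWeight d N)⁻¹ * ∑ k ∈ Finset.Icc 1 N, d k * f (normSum X a b k ω))
        atTop (𝓝 (∫ x, f x ∂H)) := by
  have hμ₂ : (2 : ℝ) ≤ μ := (le_max_left _ _).trans hμ
  exact theorem1_general P X hX hind a b d ha (fun k hk => (hd k hk).le) hD H hC1 ρ hC3 hC4 μ
    (mod_cast hμ₂) (two_lt_mul_of_max_le hr hrρ hμ) (by simpa using hmom) f hf
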